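/- **Theorem (Reverse isoperimetric inequality on $\mathbb S^2$).** Let $\gamma:\mathbb S^1\to\mathbb S^2\subset\mathbb R^3$ be a smooth, regular, simple closed curve, positively oriented as the boundary of the enclosed domain $\Omega\subset\mathbb S^2$; that is, $\Omega$ is open and connected, $\partial\Omega=\gamma(\mathbb S^1)$, and $\Omega$ lies on the side of $\gamma$ to which $\eta:=\gamma\times\gamma_s$ points, and not on the other side, where $s$ denotes arclength. Let $k_g:=\langle\gamma_{ss},\eta\rangle$ be the geodesic curvature, and assume that $\gamma$ is strictly convex, i.e. $k_g>0$ everywhere. Let $L$ be the length of $\gamma$ and $A$ the spherical area of $\Omega$. Then $A\in(0,2\pi)$, and \[ L^{2}-A(4\pi-A)\le\Bigl(\int_{\gamma}\sqrt{1+k_g^{2}}\,ds\Bigr)^{2}-4\pi^{2}. \] In fact, \[ L^{2}-A(4\pi-A)=\Bigl(\int_{\gamma}\sqrt{1+k_g^{2}}\,ds\Bigr)^{2}-4\pi^{2}-\mathcal R(\gamma), \] where \[ \mathcal R(\gamma):=\iint_{\gamma\times\gamma}\frac{(k_g(s)-k_g(\sigma))^{2}}{\sqrt{(1+k_g(s)^{2})(1+k_g(\sigma)^{2})}+1+k_g(s)k_g(\sigma)}\,ds\,d\sigma\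 \ge 0, \] the denominator being positive everywhere. Equality holds in the inequality if and only if $\gamma$ is a geodesic circle, i.e. its image is the set of all points of $\mathbb S^2$ at spherical distance $r$ from some point $p\in\mathbb S^2$, for some $r\in(0,\pi)$. -/

import Mathlib

open scoped Manifold ContDiff

namespace SphereCurve

noncomputable section

/-- Euclidean three-space. -/
abbrev E3 : Type := EuclideanSpace ℝ (Fin 3)

/-- The unit sphere `S²` in Euclidean three-space. -/
abbrev S2 : Type := Metric.sphere (0 : E3) 1

/-- The cross product on Euclidean three-space. -/
def cross (x y : E3) : E3 := WithLp.toLp 2 (crossProduct (WithLp.ofLp x) (WithLp.ofLp y))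

/-- The `2π`-periodic parametrisation `t ↦ γ(e^{it})` of a closed curve `γ : S¹ → S²`,
with values in Euclidean space. -/
def lift (γ : Circle → S2) (t : ℝ) : E3 := (γ (Circle.exp t) : E3)

/-- The speed `ds/dt`. -/
def speed (γ : Circle → S2) (t : ℝ) : ℝ := ‖deriv (lift γ) t‖

/-- The unit tangent vector `γ_s`. -/
def tangent (γ : Circle → S2) (t : ℝ) : E3 := (speed γ t)⁻¹ • deriv (lift γ) t

/-- The unit conormal `η = γ × γ_s`, pointing to the left of the curve
(the sphere being oriented by its outward normal). -/
def conormal (γ : Circle → S2) (t : ℝ) : E3 := cross (lift γ t) (tangent γ t)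

/-- The geodesic curvature `k_g = ⟨γ_ss, η⟩`, where `d/ds = (ds/dt)⁻¹ d/dt`. -/
def geodesicCurvature (γ : Circle → S2) (t : ℝ) : ℝ :=
  inner ℝ ((speed γ t)⁻¹ • deriv (tangent γ) t) (conormal γ t)

/-- The arclength integral `∫_γ f ds` of a function of the parameter. -/
def arcIntegral (γ : Circle → S2) (f : ℝ → ℝ) : ℝ :=
  ∫ t in (0 : ℝ)..(2 * Real.pi), f t * speed γ t

/-- The length of `γ`. -/
def length (γ : Circle → S2) : ℝ := arcIntegral γ (fun _ => 1)

/-- The area on the unit sphere (total mass `4π`). -/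
def area (Ω : Set S2) : ℝ :=
  (MeasureTheory.volume : MeasureTheory.Measure E3).toSphere.real Ω

/-- Smooth, regular, simple closed curves on the sphere. -/
structure IsSmoothSimpleClosed (γ : Circle → S2) : Prop where
  smooth : ContMDiff (𝓡 1) (𝓡 2) ∞ γ
  regular : ∀ t : ℝ, deriv (lift γ) t ≠ 0
  simple : Function.Injective γ

/-- `γ` is the positively oriented boundary of the domain `Ω ⊆ S²`: the domain is open and
connected, its boundary is the trace of `γ`, and it lies to the left of `γ` and not to the right,
as tested along the geodesics `ε ↦ cos ε γ + sin ε η` of the sphere normal to `γ`. -/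
structure IsPositiveBoundary (γ : Circle → S2) (Ω : Set S2) : Prop where
  isOpen : IsOpen Ω
  isConnected : IsConnected Ω
  frontier_eq : frontier Ω = Set.range γ
  left_mem : ∀ t : ℝ, ∀ᶠ ε in nhdsWithin (0 : ℝ) (Set.Ioi 0), ∀ x : S2,
    (x : E3) = Real.cos ε • lift γ t + Real.sin ε • conormal γ t → x ∈ Ω
  right_notMem : ∀ t : ℝ, ∀ᶠ ε in nhdsWithin (0 : ℝ) (Set.Ioi 0), ∀ x : S2,
    (x : E3) = Real.cos ε • lift γ t - Real.sin ε • conormal γ t → x ∉ Ω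

/-- Strict convexity of a positively oriented curve: the geodesic curvature is positive. -/
def IsStrictlyConvex (γ : Circle → S2) : Prop := ∀ t : ℝ, 0 < geodesicCurvature γ t

/-- The trace of `γ` is a geodesic circle: the set of all points at a fixed spherical distance
`r ∈ (0, π)` from a point `p` of the sphere. -/
def IsGeodesicCircle (γ : Circle → S2) : Prop :=
  ∃ p : S2, ∃ r ∈ Set.Ioo (0 : ℝ) Real.pi,
    Set.range γ = {x : S2 | InnerProductGeometry.angle (x : E3) (p : E3) = r}

/-- The denominator `√((1 + a²)(1 + b²)) + 1 + ab` in the remainder. -/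
def remainderDenom (a b : ℝ) : ℝ := √((1 + a ^ 2) * (1 + b ^ 2)) + 1 + a * b

/-- The remainder `R(γ)`. -/
def remainder (γ : Circle → S2) : ℝ :=
  arcIntegral γ fun s => arcIntegral γ fun σ =>
    (geodesicCurvature γ s - geodesicCurvature γ σ) ^ 2 /
      remainderDenom (geodesicCurvature γ s) (geodesicCurvature γ σ)

/-- The integral `∫_γ √(1 + k_g²) ds`. -/
def totalCurvature (γ : Circle → S2) : ℝ :=
  arcIntegral γ fun s => √(1 + geodesicCurvature γ s ^ 2)

end

end SphereCurve

/-!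
The cone over `Ω` lies locally on one side of each plane spanned by `γ` and `γ_s`, strictly so since
`k_g > 0`; an open connected set with this property at every boundary point is convex. Hence the
points of the sphere on no tangent great circle of `γ` are those of `±Ω`, and every other point lies
on exactly one of the half great circles issuing from `γ(s)` in the direction `γ_s(s)`. Sweeping out
the complement of `±Ω` by these half circles, with area element `k_g sin θ dθ ds`, gives
`4π - 2A = 2 ∫ k_g ds`, which is Gauss-Bonnet.

With `A = 2π - ∫ k_g ds` the deficit `L² - A(4π - A) + 4π²` equals `L² + (∫ k_g ds)²`, and
integrating `(a - b)² / (√((1 + a²)(1 + b²)) + 1 + ab) = √(1 + a²) √(1 + b²) - 1 - ab` over `γ × γ`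
compares it with `(∫ √(1 + k_g²) ds)²`. The remainder vanishes exactly when `k_g` is a constant `κ`;
then `κ γ + η` is a constant vector, so `γ` is a plane section of the sphere.
-/

namespace SphereCurve

noncomputable section

open MeasureTheory Topology
open scoped Pointwise RealInnerProductSpace ContDiff

section OpenCone

variable {E : Type*} [NormedAddCommGroup E] [NormedSpace ℝ E] {K : Set E} {p x y : E}

/-- An open cone with apex the origin, the apex excluded. -/
structure IsOpenCone (K : Set E) : Prop where
  isOpen : IsOpen K
  zero_notMem : (0 : E) ∉ K
  smul_mem : ∀ ⦃c : ℝ⦄ ⦃x : E⦄, 0 < c → x ∈ K → c • x ∈ K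

/-- Local strict convexity of a cone `K` at a boundary point `y`: near `y` the closure of `K` lies
on one side of the hyperplane `f = 0` and meets this hyperplane only in the line through `y`. -/
structure StrictlySupports (f : StrongDual ℝ E) (K : Set E) (y : E) : Prop where
  apply_eq_zero : f y = 0
  eventually_nonneg : ∀ᶠ x in 𝓝 y, x ∈ closure K →
    0 ≤ f x ∧ (f x = 0 → x ∈ Submodule.span ℝ {y})

theorem IsOpenCone.smul_mem_closure (hK : IsOpenCone K) {c : ℝ} (hc : 0 ≤ c) (hx : x ∈ closure K) :
    c • x ∈ closure K :=
  map_mem_closure₂ continuous_smul (closure_Ioi (0 : ℝ) ▸ hc) hx fun _ ha _ hb => hK.smul_mem ha hb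

theorem exists_nonpos_smul_of_zero_mem_segment (hp : p ≠ 0) (h : (0 : E) ∈ segment ℝ p x) :
    ∃ c : ℝ, c ≤ 0 ∧ x = c • p := by
  obtain ⟨a, b, ha, hb, hab, h⟩ := h
  have hb0 : b ≠ 0 := by
    rintro rfl
    exact hp (by simpa [show a = 1 by linarith] using h)
  refine ⟨-(b⁻¹ * a), neg_nonpos.2 (by positivity), ?_⟩
  have h1 : b • x = -(a • p) := by rw [eq_neg_iff_add_eq_zero, add_comm]; exact h
  rw [neg_smul, ← smul_smul, ← smul_neg, ← h1, inv_smul_smul₀ hb0]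

theorem isOpen_setOf_segment_subset (hK : IsOpen K) (p : E) :
    IsOpen {x | segment ℝ p x ⊆ K} := by
  have heq : {x | segment ℝ p x ⊆ K} = {x | ∀ s ∈ Set.Icc (0 : ℝ) 1, p + s • (x - p) ∈ K} := by
    ext x
    rw [Set.mem_ofPred_eq, segment_eq_image', Set.image_subset_iff]
    rfl
  rw [heq, isOpen_iff_mem_nhds]
  intro x hx
  refine isCompact_Icc.eventually_forall_of_forall_eventually fun s hs => ?_
  have hc : ContinuousAt (fun z : E × ℝ => p + z.2 • (z.1 - p)) (x, s) := by fun_prop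
  exact hc.eventually (hK.mem_nhds (hx s hs))

theorem segment_subset_closure (hx : x ∈ closure {x | segment ℝ p x ⊆ K}) :
    segment ℝ p x ⊆ closure K := by
  rw [segment_eq_image']
  rintro _ ⟨s, hs, rfl⟩
  refine map_mem_closure (f := fun x : E => p + s • (x - p)) (by fun_prop) hx
    fun y (hy : segment ℝ p y ⊆ K) => ?_
  rw [segment_eq_image'] at hy
  exact hy ⟨s, hs, rfl⟩

theorem one_lt_rank_quotient_span_singleton (hE : 2 < Module.rank ℝ E) (p : E) :
    1 < Module.rank ℝ (E ⧸ Submodule.span ℝ {p}) := by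
  by_contra! h
  refine hE.not_ge ?_
  rw [← Submodule.rank_quotient_add_rank (Submodule.span ℝ {p}), ← one_add_one_eq_two]
  exact add_le_add h (rank_span_le {p} |>.trans_eq (Cardinal.mk_singleton p))

theorem isPreconnected_ball_diff_of_one_lt_codim {s : Submodule ℝ E}
    (hs : 1 < Module.rank ℝ (E ⧸ s)) (hx : x ∈ s) {δ : ℝ} (hδ : 0 < δ) :
    IsPreconnected (Metric.ball x δ \ (s : Set E)) := by
  have hpos (z : E) : 0 < 1 + ‖z‖ := by positivity
  have hcont : Continuous fun z : E => x + (δ / (1 + ‖z‖)) • z := by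
    have : Continuous fun z : E => δ / (1 + ‖z‖) :=
      continuous_const.div (by fun_prop) fun z => (hpos z).ne'
    fun_prop
  convert (isConnected_compl_of_one_lt_codim hs).isPreconnected.image _ hcont.continuousOn using 1
  ext z
  constructor
  · rintro ⟨hz, hzs⟩
    have hlt : 0 < δ - ‖z - x‖ := sub_pos.2 (mem_ball_iff_norm.1 hz)
    refine ⟨(δ - ‖z - x‖)⁻¹ • (z - x), fun hmem => hzs ?_, ?_⟩
    · rwa [SetLike.mem_coe, s.smul_mem_iff (inv_ne_zero hlt.ne'), s.sub_mem_iff_left hx] at hmem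
    · have hone : δ / (1 + (δ - ‖z - x‖)⁻¹ * ‖z - x‖) * (δ - ‖z - x‖)⁻¹ = 1 := by
        field_simp
        ring
      simp only [norm_smul, norm_inv, Real.norm_of_nonneg hlt.le, smul_smul, hone, one_smul,
        add_sub_cancel]
  · rintro ⟨z, hz, rfl⟩
    refine ⟨?_, fun hmem => hz ?_⟩
    · rw [mem_ball_iff_norm, add_sub_cancel_left, norm_smul,
        Real.norm_of_nonneg (div_pos hδ (hpos z)).le, div_mul_eq_mul_div, div_lt_iff₀ (hpos z)]
      linarith
    · rwa [SetLike.mem_coe, s.add_mem_iff_right hx, s.smul_mem_iff (div_pos hδ (hpos z)).ne']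
        at hmem

theorem nonempty_ball_diff_inter {s : Submodule ℝ E} (hs : s ≠ ⊤) {S : Set E} (hS : IsOpen S)
    (hx : x ∈ closure S) {δ : ℝ} (hδ : 0 < δ) :
    ((Metric.ball x δ \ (s : Set E)) ∩ S).Nonempty := by
  by_contra! hempty
  have hsub : Metric.ball x δ ∩ S ⊆ s := fun z ⟨hzx, hzS⟩ => by
    by_contra hzs
    exact (hempty.subset ⟨⟨hzx, hzs⟩, hzS⟩ : z ∈ (∅ : Set E))
  obtain ⟨z, hz⟩ := mem_closure_iff.1 hx _ Metric.isOpen_ball (Metric.mem_ball_self hδ)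
  exact hs (s.eq_top_of_nonempty_interior'
    ⟨z, interior_maximal hsub (Metric.isOpen_ball.inter hS) hz⟩)

namespace IsOpenCone

variable (hK : IsOpenCone K)
include hK

theorem ne_zero (hx : x ∈ K) : x ≠ 0 := fun h => hK.zero_notMem (h ▸ hx)

theorem smul_mem_iff {c : ℝ} (hc : 0 < c) : c • x ∈ K ↔ x ∈ K :=
  ⟨fun h => by simpa [smul_smul, inv_mul_cancel₀ hc.ne'] using hK.smul_mem (inv_pos.2 hc) h,
    fun h => hK.smul_mem hc h⟩

theorem neg_of_smul_mem {c : ℝ} (hy : y ∉ K) (h : c • y ∈ K) : c < 0 := by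
  by_contra! hc
  rcases hc.eq_or_lt with rfl | hc
  · exact hK.zero_notMem (by rwa [zero_smul] at h)
  · exact hy ((hK.smul_mem_iff hc).1 h)

theorem smul_add_smul_mem (h : segment ℝ p x ⊆ K) {a b : ℝ} (ha : 0 ≤ a) (hb : 0 ≤ b)
    (hab : 0 < a + b) : a • p + b • x ∈ K := by
  have hmem : (a / (a + b)) • p + (b / (a + b)) • x ∈ K :=
    h ⟨a / (a + b), b / (a + b), by positivity, by positivity, by field_simp, rfl⟩
  have := hK.smul_mem hab hmem
  rwa [smul_add, smul_smul, smul_smul, mul_div_cancel₀ _ hab.ne', mul_div_cancel₀ _ hab.ne'] at this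

end IsOpenCone

theorem StrictlySupports.sub_mem_span {f : StrongDual ℝ E} (hf : StrictlySupports f K y)
    (hpx : segment ℝ p x ⊆ closure K) (hy : y ∈ openSegment ℝ p x) :
    x - p ∈ Submodule.span ℝ {y} := by
  obtain ⟨a, b, ha, hb, hab, rfl⟩ := hy
  set y := a • p + b • x
  have hnear : ∀ᶠ u : ℝ in 𝓝 0, 0 ≤ u * f (x - p) ∧
      (u * f (x - p) = 0 → y + u • (x - p) ∈ Submodule.span ℝ {y}) := by
    have hcont : ContinuousAt (fun u : ℝ => y + u • (x - p)) 0 := by fun_prop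
    have hsupp : ∀ᶠ z in 𝓝 (y + (0 : ℝ) • (x - p)), z ∈ closure K →
        0 ≤ f z ∧ (f z = 0 → z ∈ Submodule.span ℝ {y}) := by
      simpa using hf.eventually_nonneg
    filter_upwards [hcont.eventually hsupp, Ioo_mem_nhds (neg_lt_zero.2 hb) ha] with u hu hu'
    rw [map_add, hf.apply_eq_zero, map_smul, zero_add, smul_eq_mul] at hu
    refine hu (hpx ⟨a - u, b + u, ?_, ?_, by linarith, by module⟩) <;> linarith [hu'.1, hu'.2]
  obtain ⟨δ, hδ, hball⟩ := Metric.eventually_nhds_iff.1 hnear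
  have hplus := hball (y := δ / 2) (by simpa [abs_of_pos hδ] using half_lt_self hδ)
  have hminus := hball (y := -(δ / 2)) (by simpa [abs_of_pos hδ] using half_lt_self hδ)
  have hzero : f (x - p) = 0 := by nlinarith [hplus.1, hminus.1]
  have hmem := hplus.2 (by rw [hzero, mul_zero])
  rwa [Submodule.add_mem_iff_right _ (Submodule.mem_span_singleton_self y),
    Submodule.smul_mem_iff _ (half_pos hδ).ne'] at hmem

namespace IsOpenCone

variable (hK : IsOpenCone K)
include hK

theorem segment_subset
    (hsupp : ∀ y ∈ frontier K, y ≠ 0 → ∃ f : StrongDual ℝ E, StrictlySupports f K y)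
    (hp : p ∈ K) (hx : x ∈ K) (hpx : segment ℝ p x ⊆ closure K) (h0 : (0 : E) ∉ segment ℝ p x) :
    segment ℝ p x ⊆ K := by
  intro y hy
  by_contra hyK
  obtain ⟨f, hf⟩ := hsupp y (hK.isOpen.frontier_eq ▸ ⟨hpx hy, hyK⟩) fun h => h0 (h ▸ hy)
  have hyo : y ∈ openSegment ℝ p x := mem_openSegment_of_ne_left_right
    (fun h => hyK (h ▸ hp)) (fun h => hyK (h ▸ hx)) hy
  have hspan := hf.sub_mem_span hpx hyo
  obtain ⟨c, hc⟩ := Submodule.mem_span_singleton.1 hspan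
  obtain ⟨a, b, ha, hb, hab, hab_y⟩ := hyo
  have hpy : (1 - b * c) • y = p := by
    linear_combination (norm := module) (-1 : ℝ) • hab_y - b • hc + hab • p
  have hxy : (1 + a * c) • y = x := by
    linear_combination (norm := module) (-1 : ℝ) • hab_y + a • hc + hab • x
  have hneg_p := hK.neg_of_smul_mem hyK (hpy ▸ hp)
  have hneg_x := hK.neg_of_smul_mem hyK (hxy ▸ hx)
  nlinarith

theorem mem_of_segment_subset_ball_diff_span (hp : p ∈ K) {c : ℝ} (hc : c < 0) (hcp : c • p ∈ K)
    {δ : ℝ} (hδ : 0 < δ)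
    (hball : ∀ z ∈ Metric.ball (c • p) δ \ (Submodule.span ℝ {p} : Set E), segment ℝ p z ⊆ K)
    (hx : x ≠ 0) : x ∈ K := by
  by_cases hxp : x ∈ Submodule.span ℝ {p}
  · obtain ⟨d, rfl⟩ := Submodule.mem_span_singleton.1 hxp
    rcases lt_trichotomy d 0 with hd | rfl | hd
    · have := hK.smul_mem (div_pos_of_neg_of_neg hd hc) hcp
      rwa [smul_smul, div_mul_cancel₀ _ hc.ne] at this
    · exact (hx (zero_smul _ _)).elim
    · exact hK.smul_mem hd hp
  have hcont : ContinuousAt (fun u : ℝ => c • p + u • x) 0 := by fun_prop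
  obtain ⟨u, hu, hu0⟩ := ((hcont.eventually (Metric.ball_mem_nhds _ (by simpa using hδ))
    |>.filter_mono nhdsWithin_le_nhds).and (self_mem_nhdsWithin (s := Set.Ioi (0 : ℝ)))).exists
  have hspan : c • p + u • x ∉ Submodule.span ℝ {p} := by
    rwa [Submodule.add_mem_iff_right _
      (Submodule.smul_mem _ c (Submodule.mem_span_singleton_self p)),
      Submodule.smul_mem_iff _ (ne_of_gt hu0)]
  have := hK.smul_add_smul_mem (hball _ ⟨by simpa using hu, hspan⟩) (neg_nonneg.2 hc.le)
    zero_le_one (by linarith)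
  rwa [one_smul, neg_smul, neg_add_cancel_left, hK.smul_mem_iff hu0] at this

/-- The points seen from a fixed `p` within the cone form an open set, which could only fail to be
relatively closed at a point opposite to `p`; then every nonzero vector would lie in the cone. -/
theorem convex (hE : 2 < Module.rank ℝ E) (hconn : IsPreconnected K)
    (hsupp : ∀ y ∈ frontier K, y ≠ 0 → ∃ f : StrongDual ℝ E, StrictlySupports f K y)
    (hne : ∃ y ≠ 0, y ∉ K) : Convex ℝ K := by
  refine convex_iff_segment_subset.2 fun p hp => ?_
  have hSopen := isOpen_setOf_segment_subset hK.isOpen p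
  set S := {x | segment ℝ p x ⊆ K}
  have hopposite (x) (hxS : x ∈ closure S) (hxK : x ∈ K) (hx : x ∉ S) :
      ∃ c : ℝ, c < 0 ∧ x = c • p := by
    have h0 : (0 : E) ∈ segment ℝ p x := by
      by_contra h0
      exact hx (hK.segment_subset hsupp hp hxK (segment_subset_closure hxS) h0)
    obtain ⟨c, hc, rfl⟩ := exists_nonpos_smul_of_zero_mem_segment (hK.ne_zero hp) h0
    exact ⟨c, hc.lt_of_ne fun h => hK.ne_zero hxK (by rw [h, zero_smul]), rfl⟩
  refine hconn.subset_of_closure_inter_subset hSopen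
    ⟨p, hp, (segment_same ℝ p).trans_subset (Set.singleton_subset_iff.2 hp)⟩ fun x ⟨hxS, hxK⟩ => ?_
  by_contra hx
  obtain ⟨c, hc, rfl⟩ := hopposite x hxS hxK hx
  obtain ⟨δ, hδ, hball⟩ := Metric.isOpen_iff.1 hK.isOpen _ hxK
  have hcodim := one_lt_rank_quotient_span_singleton hE p
  have htop : Submodule.span ℝ {p} ≠ ⊤ := fun htop => by
    rw [htop, rank_subsingleton'] at hcodim
    exact not_lt_zero hcodim
  have hsub : Metric.ball (c • p) δ \ (Submodule.span ℝ {p} : Set E) ⊆ S := by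
    have hpre := isPreconnected_ball_diff_of_one_lt_codim hcodim
      (Submodule.smul_mem _ c (Submodule.mem_span_singleton_self p)) hδ
    refine hpre.subset_of_closure_inter_subset hSopen
      (nonempty_ball_diff_inter htop hSopen hxS hδ) fun z ⟨hzS, hz⟩ => ?_
    by_contra hz'
    obtain ⟨d, -, rfl⟩ := hopposite z hzS (hball hz.1) hz'
    exact hz.2 (Submodule.smul_mem _ d (Submodule.mem_span_singleton_self p))
  obtain ⟨y, hy0, hyK⟩ := hne
  exact hyK (hK.mem_of_segment_subset_ball_diff_span hp hc hxK hδ hsub hy0)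

end IsOpenCone

theorem StrictlySupports.nonneg_of_mem_closure {f : StrongDual ℝ E}
    (hf : StrictlySupports f K y) (hconv : Convex ℝ K) (hy : y ∈ closure K) (hx : x ∈ closure K) :
    0 ≤ f x ∧ (f x = 0 → x ∈ Submodule.span ℝ {y}) := by
  have hcont : ContinuousAt (fun u : ℝ => (1 - u) • y + u • x) 0 := by fun_prop
  have hsupp : ∀ᶠ z in 𝓝 ((1 - 0 : ℝ) • y + (0 : ℝ) • x), z ∈ closure K →
      0 ≤ f z ∧ (f z = 0 → z ∈ Submodule.span ℝ {y}) := by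
    simpa using hf.eventually_nonneg
  obtain ⟨u, hu, hu0, hu1⟩ := ((hcont.eventually hsupp).filter_mono nhdsWithin_le_nhds |>.and
    (Ioo_mem_nhdsGT (zero_lt_one' ℝ))).exists
  have h := hu (hconv.closure hy hx (sub_nonneg.2 hu1.le) hu0.le (sub_add_cancel _ _))
  rw [map_add, map_smul, hf.apply_eq_zero, smul_zero, zero_add, map_smul, smul_eq_mul,
    Submodule.add_mem_iff_right _
      (Submodule.smul_mem _ _ (Submodule.mem_span_singleton_self y)),
    Submodule.smul_mem_iff _ hu0.ne'] at h
  exact ⟨nonneg_of_mul_nonneg_right h.1 hu0, fun hx => h.2 (by rw [hx, mul_zero])⟩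

theorem IsOpenCone.smul_notMem_of_mem_closure (hK : IsOpenCone K) (hconv : Convex ℝ K)
    (hy : y ∈ closure K) {c : ℝ} (hc : c < 0) : c • y ∉ K := fun hcy => by
  rw [← hK.isOpen.interior_eq] at hcy
  have h0 := hconv.combo_interior_closure_mem_interior hcy hy
    (a := 1 / (1 - c)) (b := -c / (1 - c)) (div_pos one_pos (by linarith))
    (div_nonneg (by linarith) (by linarith)) (by field_simp [show 1 - c ≠ 0 by linarith]; ring)
  rw [smul_smul, ← add_smul, one_div_mul_eq_div, neg_div, add_neg_cancel, zero_smul] at h0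
  exact hK.zero_notMem (interior_subset h0)

theorem StrictlySupports.smul {f : StrongDual ℝ E} (hf : StrictlySupports f K y)
    (hK : IsOpenCone K) {c : ℝ} (hc : 0 < c) : StrictlySupports f K (c • y) where
  apply_eq_zero := by rw [map_smul, hf.apply_eq_zero, smul_zero]
  eventually_nonneg := by
    have htendsto : Filter.Tendsto (fun x : E => c⁻¹ • x) (𝓝 (c • y)) (𝓝 y) := by
      simpa only [inv_smul_smul₀ hc.ne'] using (continuous_const_smul c⁻¹).tendsto (c • y)
    filter_upwards [htendsto.eventually hf.eventually_nonneg] with x hx hxK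
    have h := hx (map_mem_closure (continuous_const_smul c⁻¹) hxK
      fun z hz => hK.smul_mem (inv_pos.2 hc) hz)
    rw [map_smul, smul_eq_mul, Submodule.smul_mem_iff _ (inv_ne_zero hc.ne')] at h
    rw [Submodule.span_singleton_smul_eq (isUnit_iff_ne_zero.2 hc.ne')]
    exact ⟨nonneg_of_mul_nonneg_right h.1 (inv_pos.2 hc), fun hfx => h.2 (by rw [hfx, mul_zero])⟩

theorem StrictlySupports.pos_of_mem {f : StrongDual ℝ E} (hf : StrictlySupports f K y)
    (hK : IsOpenCone K) (hconv : Convex ℝ K) (hy : y ∈ frontier K) (hx : x ∈ K) : 0 < f x := by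
  rw [hK.isOpen.frontier_eq] at hy
  obtain ⟨hnonneg, hspan⟩ := hf.nonneg_of_mem_closure hconv hy.1 (subset_closure hx)
  refine hnonneg.lt_of_ne' fun hfx => ?_
  obtain ⟨c, rfl⟩ := Submodule.mem_span_singleton.1 (hspan hfx)
  exact hK.smul_notMem_of_mem_closure hconv hy.1 (hK.neg_of_smul_mem hy.2 hx) hx

theorem mem_of_forall_pos {ι : Type*} (hK : IsOpen K) {f : ι → StrongDual ℝ E}
    (hfrontier : ∀ z ∈ frontier K, ∃ i, f i z ≤ 0) (hp : p ∈ K) (hfp : ∀ i, 0 < f i p)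
    (hfx : ∀ i, 0 < f i x) : x ∈ K := by
  refine (convex_segment p x).isPreconnected.subset_of_closure_inter_subset hK
    ⟨p, left_mem_segment ℝ p x, hp⟩ (fun z ⟨hzK, hz⟩ => ?_) (right_mem_segment ℝ p x)
  by_contra hz'
  obtain ⟨i, hi⟩ := hfrontier z (hK.frontier_eq ▸ ⟨hzK, hz'⟩)
  exact hi.not_gt ((convex_halfSpace_gt (f i).isLinear 0).segment_subset (hfp i) (hfx i) hz)

end OpenCone

section Cone

variable {E : Type*} [NormedAddCommGroup E] [NormedSpace ℝ E]
  {Ω : Set (Metric.sphere (0 : E) 1)} {r : ℝ} {x : E} {y : Metric.sphere (0 : E) 1}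

/-- The cone over a subset of the unit sphere, without its apex. -/
def cone (Ω : Set (Metric.sphere (0 : E) 1)) : Set E := Set.Ioi (0 : ℝ) • (Subtype.val '' Ω)

theorem mem_cone : x ∈ cone Ω ↔ ∃ r > (0 : ℝ), ∃ y ∈ Ω, r • (y : E) = x := by
  simp only [cone, Set.mem_smul, Set.exists_mem_image, Set.mem_Ioi, gt_iff_lt]

theorem norm_smul_coe_sphere (hr : 0 ≤ r) (y : Metric.sphere (0 : E) 1) : ‖r • (y : E)‖ = r := by
  rw [norm_smul, Real.norm_of_nonneg hr, norm_eq_of_mem_sphere, mul_one]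

theorem smul_coe_mem_cone_iff (hr : 0 < r) : r • (y : E) ∈ cone Ω ↔ y ∈ Ω := by
  refine ⟨fun h => ?_, fun hy => mem_cone.2 ⟨r, hr, y, hy, rfl⟩⟩
  obtain ⟨s, hs, z, hz, hzy⟩ := mem_cone.1 h
  obtain rfl : s = r := by
    simpa only [norm_smul_coe_sphere hs.le, norm_smul_coe_sphere hr.le] using congrArg norm hzy
  rwa [← Subtype.ext (smul_right_injective E hr.ne' hzy)]

theorem exists_smul_coe_sphere_eq (hx : x ≠ 0) :
    ∃ y : Metric.sphere (0 : E) 1, ‖x‖ • (y : E) = x :=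
  have h : ‖x‖ ≠ 0 := norm_ne_zero_iff.2 hx
  ⟨⟨‖x‖⁻¹ • x, by simp [norm_smul, h]⟩, smul_inv_smul₀ h x⟩

theorem isOpen_cone (hΩ : IsOpen Ω) : IsOpen (cone Ω) :=
  isOpen_Ioi.smul_sphere one_ne_zero Set.self_notMem_Ioi hΩ

theorem isOpenCone_cone (hΩ : IsOpen Ω) : IsOpenCone (cone Ω) where
  isOpen := isOpen_cone hΩ
  zero_notMem h := by
    obtain ⟨r, hr, y, -, hy⟩ := mem_cone.1 h
    exact hr.ne' (by rw [← norm_smul_coe_sphere hr.le y, hy, norm_zero])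
  smul_mem c x hc hx := by
    obtain ⟨r, hr, y, hy, rfl⟩ := mem_cone.1 hx
    exact mem_cone.2 ⟨c * r, mul_pos hc hr, y, hy, mul_smul _ _ _⟩

theorem isPreconnected_cone (hΩ : IsPreconnected Ω) : IsPreconnected (cone Ω) := by
  have h := (isPreconnected_Ioi (a := (0 : ℝ))).prod
    (hΩ.image _ continuous_subtype_val.continuousOn)
  rw [cone, ← Set.image_smul_prod]
  exact h.image _ continuous_smul.continuousOn

theorem smul_coe_mem_closure_cone_iff (hr : 0 < r) :
    r • (y : E) ∈ closure (cone Ω) ↔ y ∈ closure Ω := by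
  constructor
  · intro h
    by_contra hy
    obtain ⟨z, hz, hzΩ⟩ := mem_closure_iff.1 h _ (isOpen_cone isClosed_closure.isOpen_compl)
      ((smul_coe_mem_cone_iff hr).2 hy)
    obtain ⟨s, hs, w, hw, rfl⟩ := mem_cone.1 hz
    exact hw (subset_closure ((smul_coe_mem_cone_iff hs).1 hzΩ))
  · exact fun h => map_mem_closure (f := fun y : Metric.sphere (0 : E) 1 => r • (y : E))
      (by fun_prop) h fun y hy => (smul_coe_mem_cone_iff hr).2 hy

theorem smul_coe_mem_frontier_cone_iff (hΩ : IsOpen Ω) (hr : 0 < r) :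
    r • (y : E) ∈ frontier (cone Ω) ↔ y ∈ frontier Ω := by
  rw [(isOpen_cone hΩ).frontier_eq, hΩ.frontier_eq, Set.mem_sdiff, Set.mem_sdiff,
    smul_coe_mem_closure_cone_iff hr, smul_coe_mem_cone_iff hr]

theorem Ioo_smul_image_coe_eq_cone_inter_ball :
    Set.Ioo (0 : ℝ) 1 • (Subtype.val '' Ω) = cone Ω ∩ Metric.ball 0 1 := by
  ext x
  simp only [Set.mem_smul, Set.exists_mem_image, Set.mem_Ioo, Set.mem_inter_iff, mem_cone,
    mem_ball_zero_iff]
  constructor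
  · rintro ⟨r, ⟨hr0, hr1⟩, y, hy, rfl⟩
    exact ⟨⟨r, hr0, y, hy, rfl⟩, by rwa [norm_smul_coe_sphere hr0.le]⟩
  · rintro ⟨⟨r, hr, y, hy, rfl⟩, h⟩
    exact ⟨r, ⟨hr, by rwa [norm_smul_coe_sphere hr.le] at h⟩, y, hy, rfl⟩

end Cone

section CrossProduct

theorem inner_eq_sum (x y : E3) : ⟪x, y⟫ = x 0 * y 0 + x 1 * y 1 + x 2 * y 2 := by
  simp [PiLp.inner_apply, Fin.sum_univ_three, mul_comm]

@[simp] theorem cross_apply_zero (x y : E3) : cross x y 0 = x 1 * y 2 - x 2 * y 1 := by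
  simp [cross, crossProduct]

@[simp] theorem cross_apply_one (x y : E3) : cross x y 1 = x 2 * y 0 - x 0 * y 2 := by
  simp [cross, crossProduct]

@[simp] theorem cross_apply_two (x y : E3) : cross x y 2 = x 0 * y 1 - x 1 * y 0 := by
  simp [cross, crossProduct]

theorem inner_self_cross (x y : E3) : ⟪x, cross x y⟫ = 0 := by
  simp only [inner_eq_sum, cross_apply_zero, cross_apply_one, cross_apply_two]; ring

theorem inner_cross_self (x y : E3) : ⟪y, cross x y⟫ = 0 := by
  simp only [inner_eq_sum, cross_apply_zero, cross_apply_one, cross_apply_two]; ring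

theorem inner_cross_cross_self (x y : E3) :
    ⟪cross x y, cross x y⟫ = ⟪x, x⟫ * ⟪y, y⟫ - ⟪x, y⟫ ^ 2 := by
  simp only [inner_eq_sum, cross_apply_zero, cross_apply_one, cross_apply_two]; ring

theorem cross_self (x : E3) : cross x x = 0 := by
  ext i; fin_cases i <;> simp [mul_comm]

theorem cross_cross_self_left (x y : E3) : cross x (cross x y) = ⟪x, y⟫ • x - ⟪x, x⟫ • y := by
  rw [inner_eq_sum, inner_eq_sum]
  ext i; fin_cases i <;> simp <;> ring

/-- The cross product as a continuous bilinear map. -/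
def crossCLM : E3 →L[ℝ] E3 →L[ℝ] E3 :=
  LinearMap.toContinuousLinearMap
    ((LinearMap.toContinuousLinearMap : (E3 →ₗ[ℝ] E3) ≃ₗ[ℝ] (E3 →L[ℝ] E3)).toLinearMap ∘ₗ
      LinearMap.mk₂ ℝ cross
        (fun x y z => by simp [cross]) (fun c x y => by simp [cross])
        (fun x y z => by simp [cross]) (fun c x y => by simp [cross]))

theorem crossCLM_apply (x y : E3) : crossCLM x y = cross x y := rfl

variable {a b : E3}

theorem orthonormal_cross (ha : ⟪a, a⟫ = 1) (hb : ⟪b, b⟫ = 1) (hab : ⟪a, b⟫ = 0) :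
    Orthonormal ℝ ![a, b, cross a b] := by
  have hc : ⟪cross a b, cross a b⟫ = 1 := by
    rw [inner_cross_cross_self, ha, hb, hab]; norm_num
  rw [orthonormal_iff_ite]
  intro i j
  fin_cases i <;> fin_cases j <;>
    simp [-inner_self_eq_norm_sq_to_K, ha, hb, hab, hc, inner_self_cross, inner_cross_self,
      real_inner_comm a b, real_inner_comm a (cross a b), real_inner_comm b (cross a b)]

theorem eq_sum_inner_smul_of_orthonormal (ha : ⟪a, a⟫ = 1) (hb : ⟪b, b⟫ = 1) (hab : ⟪a, b⟫ = 0)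
    (x : E3) : x = ⟪a, x⟫ • a + ⟪b, x⟫ • b + ⟪cross a b, x⟫ • cross a b := by
  have hon := orthonormal_cross ha hb hab
  let B := (basisOfOrthonormalOfCardEqFinrank hon (by simp)).toOrthonormalBasis (by simpa using hon)
  have h := B.sum_repr' x
  have hB (i : Fin 3) : B i = ![a, b, cross a b] i := by simp [B]
  simp only [Fin.sum_univ_three, hB] at h
  exact h.symm

end CrossProduct

section Frame

variable {γ : Circle → S2} {t : ℝ}

/-- A smooth regular closed curve on the sphere, possibly with self-intersections, described by its
periodic parametrisation. -/
structure IsImmersed (γ : Circle → S2) : Prop where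
  contDiff_lift : ContDiff ℝ ∞ (lift γ)
  deriv_lift_ne_zero : ∀ t, deriv (lift γ) t ≠ 0

theorem IsSmoothSimpleClosed.isImmersed (hγ : IsSmoothSimpleClosed γ) : IsImmersed γ where
  contDiff_lift := by
    have : Fact (Module.finrank ℝ E3 = 2 + 1) := ⟨by simp⟩
    rw [← contMDiff_iff_contDiff]
    exact (contMDiff_coe_sphere (E := E3) (n := 2)).comp (hγ.smooth.comp contMDiff_circleExp)
  deriv_lift_ne_zero := hγ.regular

theorem periodic_deriv {F : Type*} [NormedAddCommGroup F] [NormedSpace ℝ F] {f : ℝ → F} {c : ℝ}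
    (hf : Function.Periodic f c) : Function.Periodic (deriv f) c := fun t => by
  rw [← deriv_comp_add_const, hf.funext]

theorem periodic_lift (γ : Circle → S2) : Function.Periodic (lift γ) (2 * Real.pi) := fun t => by
  simp [lift]

theorem periodic_speed (γ : Circle → S2) : Function.Periodic (speed γ) (2 * Real.pi) := fun t => by
  simp only [speed, periodic_deriv (periodic_lift γ) t]

theorem periodic_tangent (γ : Circle → S2) : Function.Periodic (tangent γ) (2 * Real.pi) :=
  fun t => by simp only [tangent, periodic_speed γ t, periodic_deriv (periodic_lift γ) t]

theorem periodic_conormal (γ : Circle → S2) : Function.Periodic (conormal γ) (2 * Real.pi) :=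
  fun t => by simp only [conormal, periodic_lift γ t, periodic_tangent γ t]

theorem periodic_geodesicCurvature (γ : Circle → S2) :
    Function.Periodic (geodesicCurvature γ) (2 * Real.pi) := fun t => by
  simp only [geodesicCurvature, periodic_speed γ t, periodic_deriv (periodic_tangent γ) t,
    periodic_conormal γ t]

theorem norm_lift (γ : Circle → S2) (t : ℝ) : ‖lift γ t‖ = 1 := norm_eq_of_mem_sphere _

theorem lift_ne_zero (γ : Circle → S2) (t : ℝ) : lift γ t ≠ 0 := ne_zero_of_mem_unit_sphere _

theorem inner_lift_lift (γ : Circle → S2) (t : ℝ) : ⟪lift γ t, lift γ t⟫ = 1 := by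
  rw [real_inner_self_eq_norm_sq, norm_lift, one_pow]

theorem inner_lift_conormal (γ : Circle → S2) (t : ℝ) : ⟪lift γ t, conormal γ t⟫ = 0 :=
  inner_self_cross _ _

theorem inner_tangent_conormal (γ : Circle → S2) (t : ℝ) : ⟪tangent γ t, conormal γ t⟫ = 0 :=
  inner_cross_self _ _

theorem inner_deriv_eq_zero_of_inner_self_eq {F : Type*} [NormedAddCommGroup F]
    [InnerProductSpace ℝ F] {f : ℝ → F} {f' : F} {c : ℝ} (hf : HasDerivAt f f' t)
    (h : ∀ t, ⟪f t, f t⟫ = c) : ⟪f t, f'⟫ = 0 := by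
  have hderiv := hf.inner ℝ hf
  simp only [h] at hderiv
  linarith [hderiv.unique (hasDerivAt_const t c), real_inner_comm (f t) f']

namespace IsImmersed

variable (hγ : IsImmersed γ)
include hγ

theorem speed_pos (t : ℝ) : 0 < speed γ t := norm_pos_iff.2 (hγ.deriv_lift_ne_zero t)

theorem contDiff_deriv_lift : ContDiff ℝ ∞ (deriv (lift γ)) :=
  (contDiff_infty_iff_deriv.1 hγ.contDiff_lift).2

theorem contDiff_speed : ContDiff ℝ ∞ (speed γ) :=
  hγ.contDiff_deriv_lift.norm ℝ hγ.deriv_lift_ne_zero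

theorem contDiff_tangent : ContDiff ℝ ∞ (tangent γ) :=
  (hγ.contDiff_speed.inv fun t => (hγ.speed_pos t).ne').smul hγ.contDiff_deriv_lift

theorem contDiff_conormal : ContDiff ℝ ∞ (conormal γ) :=
  (crossCLM.contDiff.comp hγ.contDiff_lift).clm_apply hγ.contDiff_tangent

theorem contDiff_geodesicCurvature : ContDiff ℝ ∞ (geodesicCurvature γ) :=
  ((hγ.contDiff_speed.inv fun t => (hγ.speed_pos t).ne').smul
    (contDiff_infty_iff_deriv.1 hγ.contDiff_tangent).2).inner ℝ hγ.contDiff_conormal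

theorem inner_tangent_tangent (t : ℝ) : ⟪tangent γ t, tangent γ t⟫ = 1 := by
  rw [tangent, real_inner_smul_left, real_inner_smul_right, real_inner_self_eq_norm_sq, ← speed]
  field_simp [(hγ.speed_pos t).ne']

theorem hasDerivAt_lift (t : ℝ) : HasDerivAt (lift γ) (speed γ t • tangent γ t) t := by
  rw [tangent, smul_inv_smul₀ (hγ.speed_pos t).ne']
  exact (hγ.contDiff_lift.differentiable (by simp) t).hasDerivAt

theorem inner_lift_tangent (t : ℝ) : ⟪lift γ t, tangent γ t⟫ = 0 := by
  have h := inner_deriv_eq_zero_of_inner_self_eq (hγ.hasDerivAt_lift t) (inner_lift_lift γ)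
  rw [real_inner_smul_right] at h
  exact (mul_eq_zero.1 h).resolve_left (hγ.speed_pos t).ne'

theorem inner_conormal_conormal (t : ℝ) : ⟪conormal γ t, conormal γ t⟫ = 1 := by
  rw [conormal, inner_cross_cross_self, inner_lift_lift, hγ.inner_tangent_tangent,
    hγ.inner_lift_tangent, mul_one, zero_pow two_ne_zero, sub_zero]

theorem frame_expansion (t : ℝ) (x : E3) :
    x = ⟪lift γ t, x⟫ • lift γ t + ⟪tangent γ t, x⟫ • tangent γ t
      + ⟪conormal γ t, x⟫ • conormal γ t :=
  eq_sum_inner_smul_of_orthonormal (inner_lift_lift γ t) (hγ.inner_tangent_tangent t)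
    (hγ.inner_lift_tangent t) x

theorem inner_self_eq_sum (t : ℝ) (x : E3) :
    ⟪x, x⟫ = ⟪lift γ t, x⟫ ^ 2 + ⟪tangent γ t, x⟫ ^ 2 + ⟪conormal γ t, x⟫ ^ 2 := by
  conv_lhs => enter [2]; rw [hγ.frame_expansion t x]
  simp only [inner_add_right, real_inner_smul_right, real_inner_comm x]
  ring

theorem hasDerivAt_tangent (t : ℝ) :
    HasDerivAt (tangent γ) (speed γ t • (-lift γ t + geodesicCurvature γ t • conormal γ t)) t := by
  have hT := (hγ.contDiff_tangent.differentiable (by simp) t).hasDerivAt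
  have hlift : ⟪lift γ t, deriv (tangent γ) t⟫ = -speed γ t := by
    have h := (hγ.hasDerivAt_lift t).inner ℝ hT
    simp only [hγ.inner_lift_tangent] at h
    have h0 := h.unique (hasDerivAt_const t (0 : ℝ))
    rw [real_inner_smul_left, hγ.inner_tangent_tangent, mul_one] at h0
    exact eq_neg_of_add_eq_zero_left h0
  have hconormal : ⟪conormal γ t, deriv (tangent γ) t⟫ = speed γ t * geodesicCurvature γ t := by
    rw [geodesicCurvature, real_inner_smul_left, mul_inv_cancel_left₀ (hγ.speed_pos t).ne',
      real_inner_comm]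
  refine hT.congr_deriv ((hγ.frame_expansion t _).trans ?_)
  rw [hlift, hconormal, inner_deriv_eq_zero_of_inner_self_eq hT hγ.inner_tangent_tangent]
  module

theorem hasDerivAt_conormal (t : ℝ) :
    HasDerivAt (conormal γ) (-(speed γ t * geodesicCurvature γ t) • tangent γ t) t := by
  refine ((crossCLM.hasFDerivAt.comp_hasDerivAt t (hγ.hasDerivAt_lift t)).clm_apply
    (hγ.hasDerivAt_tangent t)).congr_deriv ?_
  simp only [Function.comp_apply, map_smul, map_add, map_neg, crossCLM_apply,
    smul_apply, cross_self, conormal]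
  rw [cross_cross_self_left, hγ.inner_lift_tangent, inner_lift_lift]
  module

theorem hasDerivAt_inner_lift (t : ℝ) (x : E3) :
    HasDerivAt (fun t => ⟪lift γ t, x⟫) (speed γ t * ⟪tangent γ t, x⟫) t := by
  simpa [real_inner_smul_left] using (hγ.hasDerivAt_lift t).inner ℝ (hasDerivAt_const t x)

theorem hasDerivAt_inner_tangent (t : ℝ) (x : E3) :
    HasDerivAt (fun t => ⟪tangent γ t, x⟫)
      (speed γ t * (-⟪lift γ t, x⟫ + geodesicCurvature γ t * ⟪conormal γ t, x⟫)) t := by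
  simpa [real_inner_smul_left, inner_add_left, inner_neg_left, mul_add] using
    (hγ.hasDerivAt_tangent t).inner ℝ (hasDerivAt_const t x)

theorem hasDerivAt_inner_conormal (t : ℝ) (x : E3) :
    HasDerivAt (fun t => ⟪conormal γ t, x⟫)
      (-(speed γ t * geodesicCurvature γ t * ⟪tangent γ t, x⟫)) t := by
  simpa [real_inner_smul_left] using (hγ.hasDerivAt_conormal t).inner ℝ (hasDerivAt_const t x)

theorem exists_inner_conormal_ne_zero (hk : ∀ t, geodesicCurvature γ t ≠ 0) {x : E3}
    (hx : x ≠ 0) : ∃ t, ⟪conormal γ t, x⟫ ≠ 0 := by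
  by_contra! hη
  have hT (t : ℝ) : ⟪tangent γ t, x⟫ = 0 := by
    have h := hγ.hasDerivAt_inner_conormal t x
    simp only [hη] at h
    simpa [(hγ.speed_pos t).ne', hk t] using h.unique (hasDerivAt_const t (0 : ℝ))
  have hlift : ⟪lift γ 0, x⟫ = 0 := by
    have h := hγ.hasDerivAt_inner_tangent 0 x
    simp only [hη, hT] at h
    simpa [(hγ.speed_pos 0).ne'] using h.unique (hasDerivAt_const 0 (0 : ℝ))
  exact hx (by rw [hγ.frame_expansion 0 x, hη, hT, hlift]; simp)

end IsImmersed

end Frame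

section NormalCoordinates

variable {γ : Circle → S2} {Ω : Set S2} {t : ℝ}

theorem eventually_lt_of_hasDerivAt_of_hasDerivAt {f f' : ℝ → ℝ} {a c : ℝ}
    (hf : ∀ t, HasDerivAt f (f' t) t) (ha : f' a = 0) (hf' : HasDerivAt f' c a) (hc : 0 < c) :
    ∀ᶠ t in 𝓝[≠] a, f a < f t := by
  have hcont : Continuous f := continuous_iff_continuousAt.2 fun t => (hf t).continuousAt
  have hsign := eventually_nhdsWithin_sign_eq_of_deriv_pos (hf'.deriv.symm ▸ hc) ha
  obtain ⟨δ, hδ, hball⟩ := Metric.eventually_nhds_iff_ball.1 hsign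
  refine eventually_nhdsWithin_iff.2 (Filter.eventually_of_mem (Metric.ball_mem_nhds a hδ) ?_)
  intro t ht hta
  rw [Real.ball_eq_Ioo] at ht hball
  rcases lt_or_gt_of_ne hta with h | h
  · refine strictAntiOn_of_deriv_neg (convex_Icc t a) hcont.continuousOn (fun x hx => ?_)
      (Set.left_mem_Icc.2 h.le) (Set.right_mem_Icc.2 h.le) h
    rw [interior_Icc] at hx
    rw [(hf x).deriv, ← sign_eq_neg_one_iff, hball x ⟨ht.1.trans hx.1, by linarith [hx.2]⟩,
      sign_eq_neg_one_iff, sub_neg]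
    exact hx.2
  · refine strictMonoOn_of_deriv_pos (convex_Icc a t) hcont.continuousOn (fun x hx => ?_)
      (Set.left_mem_Icc.2 h.le) (Set.right_mem_Icc.2 h.le) h
    rw [interior_Icc] at hx
    rw [(hf x).deriv, ← sign_eq_one_iff, hball x ⟨by linarith [hx.1], hx.2.trans ht.2⟩,
      sign_eq_one_iff, sub_pos]
    exact hx.1

theorem IsImmersed.eventually_inner_lift_conormal_pos (hγ : IsImmersed γ)
    (hk : 0 < geodesicCurvature γ t) : ∀ᶠ s in 𝓝[≠] t, 0 < ⟪lift γ s, conormal γ t⟫ := by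
  rw [← inner_lift_conormal γ t]
  refine eventually_lt_of_hasDerivAt_of_hasDerivAt
    (fun s => hγ.hasDerivAt_inner_lift s (conormal γ t))
    (by rw [inner_tangent_conormal, mul_zero])
    ((hγ.contDiff_speed.differentiable (by simp) t).hasDerivAt.mul
      (hγ.hasDerivAt_inner_tangent t (conormal γ t))) ?_
  rw [inner_tangent_conormal, inner_lift_conormal, hγ.inner_conormal_conormal, mul_zero, zero_add,
    neg_zero, zero_add, mul_one]
  exact mul_pos (hγ.speed_pos t) (mul_pos (hγ.speed_pos t) hk)

/-- Geodesic normal coordinates along the curve, extended radially to space: `(t, ε, r)` is mapped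
to the point at distance `r` from the origin in the direction reached from `γ` at parameter `t` by
following for time `ε` the unit speed geodesic in the conormal direction. -/
def normalCoord (γ : Circle → S2) (z : ℝ × ℝ × ℝ) : E3 :=
  z.2.2 • (Real.cos z.2.1 • lift γ z.1 + Real.sin z.2.1 • conormal γ z.1)

theorem normalCoord_zero (γ : Circle → S2) (t r : ℝ) : normalCoord γ (t, 0, r) = r • lift γ t := by
  simp [normalCoord]

theorem IsImmersed.contDiff_normalCoord (hγ : IsImmersed γ) : ContDiff ℝ ∞ (normalCoord γ) := by
  have := hγ.contDiff_lift
  have := hγ.contDiff_conormal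
  unfold normalCoord
  fun_prop

theorem IsImmersed.norm_normalCoord (hγ : IsImmersed γ) (z : ℝ × ℝ × ℝ) :
    ‖normalCoord γ z‖ = |z.2.2| := by
  have hunit : ‖Real.cos z.2.1 • lift γ z.1 + Real.sin z.2.1 • conormal γ z.1‖ = 1 := by
    rw [← sq_eq_sq₀ (norm_nonneg _) zero_le_one, ← real_inner_self_eq_norm_sq]
    simp only [inner_add_left, inner_add_right, real_inner_smul_left, real_inner_smul_right,
      inner_lift_lift, hγ.inner_conormal_conormal, inner_lift_conormal,
      real_inner_comm (lift γ z.1) (conormal γ z.1)]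
    linear_combination Real.cos_sq_add_sin_sq z.2.1
  rw [normalCoord, norm_smul, hunit, mul_one, Real.norm_eq_abs]

theorem IsImmersed.fderiv_normalCoord_apply (hγ : IsImmersed γ) (t : ℝ) (w : ℝ × ℝ × ℝ) :
    fderiv ℝ (normalCoord γ) (t, 0, 1) w =
      (w.1 * speed γ t) • tangent γ t + w.2.1 • conormal γ t + w.2.2 • lift γ t := by
  have hfst : HasFDerivAt (fun z : ℝ × ℝ × ℝ => z.1) (ContinuousLinearMap.fst ℝ ℝ (ℝ × ℝ))
    (t, 0, 1) := hasFDerivAt_fst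
  have hL := (hγ.hasDerivAt_lift t).hasFDerivAt.comp (t, (0 : ℝ), (1 : ℝ)) hfst
  have hN := (hγ.hasDerivAt_conormal t).hasFDerivAt.comp (t, (0 : ℝ), (1 : ℝ)) hfst
  have hε : HasFDerivAt (fun z : ℝ × ℝ × ℝ => z.2.1) _ (t, 0, 1) :=
    (ContinuousLinearMap.fst ℝ ℝ ℝ ∘L ContinuousLinearMap.snd ℝ ℝ (ℝ × ℝ)).hasFDerivAt
  have hr : HasFDerivAt (fun z : ℝ × ℝ × ℝ => z.2.2) _ (t, 0, 1) :=
    (ContinuousLinearMap.snd ℝ ℝ ℝ ∘L ContinuousLinearMap.snd ℝ ℝ (ℝ × ℝ)).hasFDerivAt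
  have h : HasFDerivAt (normalCoord γ) _ (t, 0, 1) :=
    hr.smul ((hε.cos.smul hL).add (hε.sin.smul hN))
  rw [h.fderiv]
  simp only [Real.cos_zero, one_smul, Real.sin_zero, neg_zero, zero_smul, Function.comp_apply,
    ContinuousLinearMap.zero_smulRight, add_zero, neg_smul, zero_add, smul_add, add_apply,
    ContinuousLinearMap.comp_apply, ContinuousLinearMap.coe_fst',
    ContinuousLinearMap.toSpanSingleton_apply, ContinuousLinearMap.smulRight_apply,
    ContinuousLinearMap.coe_snd']
  module

theorem IsImmersed.exists_openPartialHomeomorph_normalCoord (hγ : IsImmersed γ) (t : ℝ) :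
    ∃ Φ : OpenPartialHomeomorph (ℝ × ℝ × ℝ) E3, ⇑Φ = normalCoord γ ∧ (t, 0, 1) ∈ Φ.source := by
  have hinj : Function.Injective (fderiv ℝ (normalCoord γ) (t, 0, 1)).toLinearMap := by
    refine LinearMap.ker_eq_bot.1 (LinearMap.ker_eq_bot'.2 fun w hw => ?_)
    rw [ContinuousLinearMap.coe_coe, hγ.fderiv_normalCoord_apply] at hw
    have hT := congrArg (fun x => ⟪tangent γ t, x⟫) hw
    have hN := congrArg (fun x => ⟪conormal γ t, x⟫) hw
    have hL := congrArg (fun x => ⟪lift γ t, x⟫) hw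
    simp only [inner_add_right, real_inner_smul_right, inner_zero_right, inner_lift_lift,
      hγ.inner_tangent_tangent, hγ.inner_conormal_conormal, hγ.inner_lift_tangent,
      inner_lift_conormal, inner_tangent_conormal, real_inner_comm (tangent γ t) (conormal γ t),
      real_inner_comm (lift γ t) (tangent γ t), real_inner_comm (lift γ t) (conormal γ t),
      mul_one, mul_zero, add_zero, zero_add] at hT hN hL
    exact Prod.ext ((mul_eq_zero.1 hT).resolve_right (hγ.speed_pos t).ne') (Prod.ext hN hL)
  let e := (LinearMap.linearEquivOfInjective _ hinj (by simp)).toContinuousLinearEquiv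
  have he : HasStrictFDerivAt (normalCoord γ) (e : ℝ × ℝ × ℝ →L[ℝ] E3) (t, 0, 1) :=
    hγ.contDiff_normalCoord.contDiffAt.hasStrictFDerivAt (by simp)
  exact ⟨he.toOpenPartialHomeomorph _, he.toOpenPartialHomeomorph_coe,
    he.mem_toOpenPartialHomeomorph_source⟩

theorem IsSmoothSimpleClosed.eventually_exists_normalCoord_eq (hγ : IsSmoothSimpleClosed γ) (t : ℝ)
    {W : Set (ℝ × ℝ × ℝ)} (hW : W ∈ 𝓝 (t, 0, 1)) :
    ∀ᶠ x in 𝓝 (lift γ t), ∀ s, ∀ r > 0, r • lift γ s = x →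
      ∃ u, (u, 0, r) ∈ W ∧ normalCoord γ (u, 0, r) = x := by
  have hemb : IsEmbedding fun z : Circle => (γ z : E3) :=
    (Continuous.isClosedEmbedding (continuous_subtype_val.comp hγ.smooth.continuous)
      (Subtype.val_injective.comp hγ.simple)).isEmbedding
  obtain ⟨U, hU, V', hV', hUV⟩ := mem_nhds_prod_iff.1 hW
  obtain ⟨V₀, hV₀, V, hV, hVV⟩ := mem_nhds_prod_iff.1 hV'
  have hexp : Circle.exp '' U ∈ 𝓝 (Circle.exp t) :=
    isLocalHomeomorph_circleExp.isOpenMap.image_mem_nhds hU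
  rw [hemb.nhds_eq_comap, Filter.mem_comap] at hexp
  obtain ⟨M, hM, hMU⟩ := hexp
  have hnorm : Filter.Tendsto (fun x : E3 => ‖x‖) (𝓝 (lift γ t)) (𝓝 1) := by
    simpa only [norm_lift] using (continuous_norm (E := E3)).tendsto (lift γ t)
  have hdir : Filter.Tendsto (fun x : E3 => ‖x‖⁻¹ • x) (𝓝 (lift γ t)) (𝓝 (lift γ t)) := by
    simpa using (hnorm.inv₀ one_ne_zero).smul (Filter.tendsto_id (x := 𝓝 (lift γ t)))
  filter_upwards [hdir hM, hnorm hV] with x hxM hxV s r hr hx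
  rw [Set.mem_preimage, ← hx, norm_smul, norm_lift, mul_one, Real.norm_of_nonneg hr.le] at hxM hxV
  rw [inv_smul_smul₀ hr.ne'] at hxM
  obtain ⟨u, hu, hus⟩ := hMU hxM
  refine ⟨u, hUV ⟨hu, hVV ⟨mem_of_mem_nhds hV₀, hxV⟩⟩, ?_⟩
  rw [normalCoord_zero, ← hx, lift, lift, hus]

theorem IsPositiveBoundary.lift_mem_frontier_cone (hΩ : IsPositiveBoundary γ Ω) (t : ℝ) :
    lift γ t ∈ frontier (cone Ω) := by
  rw [← one_smul ℝ (lift γ t), lift, smul_coe_mem_frontier_cone_iff hΩ.isOpen one_pos,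
    hΩ.frontier_eq]
  exact Set.mem_range_self _

theorem IsPositiveBoundary.exists_smul_lift_eq_of_mem_frontier_cone (hΩ : IsPositiveBoundary γ Ω)
    {x : E3} (hx : x ∈ frontier (cone Ω)) (hx0 : x ≠ 0) : ∃ s, ∃ r > (0 : ℝ), r • lift γ s = x := by
  obtain ⟨y, hy⟩ := exists_smul_coe_sphere_eq hx0
  rw [← hy, smul_coe_mem_frontier_cone_iff hΩ.isOpen (norm_pos_iff.2 hx0), hΩ.frontier_eq] at hx
  obtain ⟨z, rfl⟩ := hx
  obtain ⟨s, rfl⟩ := Circle.exp_surjective z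
  exact ⟨s, ‖x‖, norm_pos_iff.2 hx0, hy⟩

theorem IsPositiveBoundary.eventually_eq_zero_of_normalCoord_mem_frontier
    (hΩ : IsPositiveBoundary γ Ω) (hγ : IsSmoothSimpleClosed γ) (t : ℝ) :
    ∀ᶠ z in 𝓝 (t, 0, 1), normalCoord γ z ∈ frontier (cone Ω) → z.2.1 = 0 := by
  obtain ⟨Φ, hΦ, ht⟩ := hγ.isImmersed.exists_openPartialHomeomorph_normalCoord t
  have hsource := Φ.open_source.mem_nhds ht
  have hlift : Filter.Tendsto (normalCoord γ) (𝓝 (t, 0, 1)) (𝓝 (lift γ t)) := by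
    have := hγ.isImmersed.contDiff_normalCoord.continuous.tendsto (t, 0, 1)
    rwa [normalCoord_zero, one_smul] at this
  filter_upwards [hsource, hlift.eventually (hγ.eventually_exists_normalCoord_eq t hsource),
    hlift.eventually_ne (lift_ne_zero γ t)] with z hz hparam hz0 hfrontier
  obtain ⟨s, r, hr, hs⟩ := hΩ.exists_smul_lift_eq_of_mem_frontier_cone hfrontier hz0
  obtain ⟨u, hu, huz⟩ := hparam s r hr hs
  rw [← Φ.injOn hu hz (by rwa [hΦ])]

theorem IsPositiveBoundary.frequently_normalCoord_notMem_cone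
    (hΩ : IsPositiveBoundary γ Ω) (hγ : IsImmersed γ) (t : ℝ) :
    ∃ᶠ z in 𝓝 (t, 0, 1), z.2.1 < 0 ∧ normalCoord γ z ∉ cone Ω := by
  have htendsto : Filter.Tendsto (fun ε : ℝ => (t, -ε, (1 : ℝ))) (𝓝[>] 0) (𝓝 (t, 0, 1)) := by
    have : Continuous fun ε : ℝ => (t, -ε, (1 : ℝ)) := by fun_prop
    simpa using (this.tendsto 0).mono_left nhdsWithin_le_nhds
  refine htendsto.frequently (Filter.Eventually.frequently ?_)
  filter_upwards [hΩ.right_notMem t, self_mem_nhdsWithin] with ε hε hε0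
  refine ⟨neg_neg_of_pos hε0, fun hmem => ?_⟩
  obtain ⟨r, hr, y, hy, hry⟩ := mem_cone.1 hmem
  have hr1 : r = 1 := by
    rw [← norm_smul_coe_sphere hr.le y, hry, hγ.norm_normalCoord, abs_one]
  rw [hr1, one_smul] at hry
  refine hε y ?_ hy
  simp [hry, normalCoord, sub_eq_add_neg]

/-- A full neighbourhood of a boundary point splits into the two sides `ε > 0` and `ε < 0` of the
curve. The side `ε < 0` is connected and misses the frontier, so one point outside suffices. -/
theorem IsPositiveBoundary.eventually_nonneg_of_normalCoord_mem_closure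
    (hΩ : IsPositiveBoundary γ Ω) (hγ : IsSmoothSimpleClosed γ) (t : ℝ) :
    ∀ᶠ z in 𝓝 (t, 0, 1), normalCoord γ z ∈ closure (cone Ω) → 0 ≤ z.2.1 := by
  obtain ⟨δ, hδ, hball⟩ := Metric.eventually_nhds_iff_ball.1
    (hΩ.eventually_eq_zero_of_normalCoord_mem_frontier hγ t)
  obtain ⟨w, ⟨hw0, hwK⟩, hw⟩ := ((hΩ.frequently_normalCoord_notMem_cone hγ.isImmersed t)
    |>.and_eventually (Metric.ball_mem_nhds _ hδ)).exists
  filter_upwards [Metric.ball_mem_nhds _ hδ] with z hz hzK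
  by_contra! hz0
  set H := Metric.ball ((t, 0, 1) : ℝ × ℝ × ℝ) δ ∩ {z | z.2.1 < 0}
  have hH : IsPreconnected H := ((convex_ball _ _).inter (convex_halfSpace_lt
    (f := fun z : ℝ × ℝ × ℝ => z.2.1) ⟨fun _ _ => rfl, fun _ _ => rfl⟩ 0)).isPreconnected
  have hmem (u) (hu : u ∈ H) (huK : normalCoord γ u ∈ closure (cone Ω)) :
      normalCoord γ u ∈ cone Ω := by
    by_contra hu'
    exact hu.2.ne (hball u hu.1 ((isOpen_cone hΩ.isOpen).frontier_eq ▸ ⟨huK, hu'⟩))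
  refine hwK (((hH.image _ hγ.isImmersed.contDiff_normalCoord.continuous.continuousOn)
    |>.subset_of_closure_inter_subset (isOpen_cone hΩ.isOpen)
      ⟨_, Set.mem_image_of_mem _ ⟨hz, hz0⟩, hmem z ⟨hz, hz0⟩ hzK⟩ ?_)
    (Set.mem_image_of_mem _ ⟨hw, hw0⟩))
  rintro _ ⟨huK, u, hu, rfl⟩
  exact hmem u hu huK

end NormalCoordinates

section ConvexDomain

variable {γ : Circle → S2} {Ω : Set S2} {x : E3}

theorem IsImmersed.eventually_inner_conormal_normalCoord_nonneg (hγ : IsImmersed γ) {t : ℝ}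
    (hk : 0 < geodesicCurvature γ t) :
    ∀ᶠ z in 𝓝 (t, 0, 1), 0 ≤ z.2.1 → 0 ≤ ⟪conormal γ t, normalCoord γ z⟫ ∧
      (⟪conormal γ t, normalCoord γ z⟫ = 0 → normalCoord γ z ∈ Submodule.span ℝ {lift γ t}) := by
  have htendsto : Filter.Tendsto (fun z : ℝ × ℝ × ℝ => z.1) (𝓝 (t, 0, 1)) (𝓝 t) :=
    continuous_fst.tendsto _
  have hlift := htendsto.eventually
    (eventually_nhdsWithin_iff.1 (hγ.eventually_inner_lift_conormal_pos hk))
  have hconormal : ∀ᶠ s in 𝓝 t, 0 < ⟪conormal γ s, conormal γ t⟫ := by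
    have hcont : Continuous fun s => ⟪conormal γ s, conormal γ t⟫ :=
      hγ.contDiff_conormal.continuous.inner continuous_const
    exact (hcont.tendsto t).eventually_const_lt (by rw [hγ.inner_conormal_conormal]; exact one_pos)
  have hε : ∀ᶠ z : ℝ × ℝ × ℝ in 𝓝 (t, 0, 1), z.2.1 < Real.pi / 2 :=
    (continuous_snd.fst.tendsto _).eventually_lt_const Real.pi_div_two_pos
  have hr : ∀ᶠ z : ℝ × ℝ × ℝ in 𝓝 (t, 0, 1), 0 < z.2.2 :=
    (continuous_snd.snd.tendsto _).eventually_const_lt one_pos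
  filter_upwards [hlift, htendsto.eventually hconormal, hε, hr] with z hlift hconormal hε hr hε0
  have hcos := Real.cos_pos_of_mem_Ioo ⟨by linarith [Real.pi_pos], hε⟩
  have hsin := Real.sin_nonneg_of_nonneg_of_le_pi hε0 (by linarith [Real.pi_pos])
  have hlift_nonneg : 0 ≤ ⟪lift γ z.1, conormal γ t⟫ := by
    by_cases h : z.1 = t
    · rw [h, inner_lift_conormal]
    · exact (hlift h).le
  have hinner : ⟪conormal γ t, normalCoord γ z⟫ = z.2.2 * (Real.cos z.2.1 *
      ⟪lift γ z.1, conormal γ t⟫ + Real.sin z.2.1 * ⟪conormal γ z.1, conormal γ t⟫) := by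
    rw [real_inner_comm, normalCoord, real_inner_smul_left, inner_add_left, real_inner_smul_left,
      real_inner_smul_left]
  have h₁ := mul_nonneg hcos.le hlift_nonneg
  have h₂ := mul_nonneg hsin hconormal.le
  refine ⟨hinner ▸ mul_nonneg hr.le (add_nonneg h₁ h₂), fun h => ?_⟩
  rw [hinner, mul_eq_zero, or_iff_right hr.ne', add_eq_zero_iff_of_nonneg h₁ h₂, mul_eq_zero,
    or_iff_right hcos.ne', mul_eq_zero, or_iff_left hconormal.ne'] at h
  have hz : z.1 = t := by
    by_contra hne
    exact (hlift hne).ne' h.1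
  rw [normalCoord, h.2, zero_smul, add_zero, hz, smul_smul]
  exact Submodule.smul_mem _ _ (Submodule.mem_span_singleton_self _)

namespace IsPositiveBoundary

variable (hΩ : IsPositiveBoundary γ Ω) (hγ : IsSmoothSimpleClosed γ)
include hΩ hγ

theorem strictlySupports_conormal {t : ℝ} (hk : 0 < geodesicCurvature γ t) :
    StrictlySupports (innerSL ℝ (conormal γ t)) (cone Ω) (lift γ t) where
  apply_eq_zero := by rw [innerSL_apply_apply, real_inner_comm, inner_lift_conormal]
  eventually_nonneg := by
    obtain ⟨Φ, hΦ, ht⟩ := hγ.isImmersed.exists_openPartialHomeomorph_normalCoord t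
    have hmap := Φ.map_nhds_eq ht
    rw [hΦ, normalCoord_zero, one_smul] at hmap
    rw [← hmap, Filter.eventually_map]
    filter_upwards [hΩ.eventually_nonneg_of_normalCoord_mem_closure hγ t,
      hγ.isImmersed.eventually_inner_conormal_normalCoord_nonneg hk] with z hz hz' hzK
    exact hz' (hz hzK)

variable (hk : IsStrictlyConvex γ)
include hk

theorem convex_cone : Convex ℝ (cone Ω) := by
  refine (isOpenCone_cone hΩ.isOpen).convex ?_ (isPreconnected_cone hΩ.isConnected.isPreconnected)
    (fun y hy hy0 => ?_) ⟨lift γ 0, lift_ne_zero γ 0, ?_⟩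
  · rw [rank_eq_card_basis (EuclideanSpace.basisFun (Fin 3) ℝ).toBasis]
    norm_num
  · obtain ⟨t, r, hr, rfl⟩ := hΩ.exists_smul_lift_eq_of_mem_frontier_cone hy hy0
    exact ⟨_, (hΩ.strictlySupports_conormal hγ (hk t)).smul (isOpenCone_cone hΩ.isOpen) hr⟩
  · exact ((isOpen_cone hΩ.isOpen).frontier_eq ▸ hΩ.lift_mem_frontier_cone 0).2

theorem inner_conormal_nonneg (hx : x ∈ closure (cone Ω)) (t : ℝ) : 0 ≤ ⟪conormal γ t, x⟫ ∧
    (⟪conormal γ t, x⟫ = 0 → x ∈ Submodule.span ℝ {lift γ t}) :=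
  (hΩ.strictlySupports_conormal hγ (hk t)).nonneg_of_mem_closure (hΩ.convex_cone hγ hk)
    (frontier_subset_closure (hΩ.lift_mem_frontier_cone t)) hx

theorem mem_cone_iff_inner_conormal_pos : x ∈ cone Ω ↔ ∀ t, 0 < ⟪conormal γ t, x⟫ := by
  have hpos (y) (hy : y ∈ cone Ω) (t) : 0 < innerSL ℝ (conormal γ t) y :=
    (hΩ.strictlySupports_conormal hγ (hk t)).pos_of_mem (isOpenCone_cone hΩ.isOpen)
      (hΩ.convex_cone hγ hk) (hΩ.lift_mem_frontier_cone t) hy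
  refine ⟨hpos x, fun hx => ?_⟩
  obtain ⟨y, hyΩ⟩ := hΩ.isConnected.nonempty
  have hy : (1 : ℝ) • (y : E3) ∈ cone Ω := (smul_coe_mem_cone_iff one_pos).2 hyΩ
  refine mem_of_forall_pos (isOpen_cone hΩ.isOpen) (fun z hz => ?_) hy (hpos _ hy) hx
  by_cases hz0 : z = 0
  · exact ⟨0, by rw [hz0, map_zero]⟩
  · obtain ⟨t, r, -, rfl⟩ := hΩ.exists_smul_lift_eq_of_mem_frontier_cone hz hz0
    exact ⟨t, by rw [innerSL_apply_apply, real_inner_smul_right, real_inner_comm,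
      inner_lift_conormal, mul_zero]⟩

theorem eq_zero_of_mem_closure_cone_of_neg_mem_closure_cone (hx : x ∈ closure (cone Ω))
    (hx' : -x ∈ closure (cone Ω)) : x = 0 := by
  by_contra hx0
  obtain ⟨t, ht⟩ := hγ.isImmersed.exists_inner_conormal_ne_zero (fun t => (hk t).ne') hx0
  have h := (hΩ.inner_conormal_nonneg hγ hk hx t).1
  have h' := (hΩ.inner_conormal_nonneg hγ hk hx' t).1
  rw [inner_neg_right, neg_nonneg] at h'
  exact ht (h'.antisymm h)

end IsPositiveBoundary

end ConvexDomain

section TangentCoord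

theorem cross_add_smul (a b c d : ℝ) (x y : E3) :
    cross (a • x + b • y) (c • x + d • y) = (a * d - b * c) • cross x y := by
  ext i; fin_cases i <;> simp <;> ring

theorem inner_cross_antisymm (x y z : E3) : ⟪x, cross y z⟫ = -⟪y, cross x z⟫ := by
  simp only [inner_eq_sum, cross_apply_zero, cross_apply_one, cross_apply_two]; ring

theorem det_eq_inner_cross (A : E3 →L[ℝ] E3) :
    A.det = ⟪A (EuclideanSpace.single 0 1),
      cross (A (EuclideanSpace.single 1 1)) (A (EuclideanSpace.single 2 1))⟫ := by
  rw [ContinuousLinearMap.det,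
    ← LinearMap.det_toMatrix (EuclideanSpace.basisFun (Fin 3) ℝ).toBasis, Matrix.det_fin_three,
    inner_eq_sum]
  simp only [LinearMap.toMatrix_apply, OrthonormalBasis.coe_toBasis,
    EuclideanSpace.basisFun_apply, OrthonormalBasis.coe_toBasis_repr_apply,
    EuclideanSpace.basisFun_repr, ContinuousLinearMap.coe_coe, cross_apply_zero, cross_apply_one,
    cross_apply_two]
  ring

theorem setIntegral_prod_eq_prod_setIntegral {ι : Type*} [Fintype ι] (S : ι → Set ℝ)
    (f : ι → ℝ → ℝ) :
    ∫ z : EuclideanSpace ℝ ι in {z | ∀ i, z i ∈ S i}, ∏ i, f i (z i) =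
      ∏ i, ∫ x in S i, f i x := by
  have hS : {z : EuclideanSpace ℝ ι | ∀ i, z i ∈ S i} = WithLp.ofLp ⁻¹' Set.univ.pi S := by
    ext z; simp
  rw [hS, (PiLp.volume_preserving_ofLp ι).setIntegral_preimage_emb
    (MeasurableEquiv.toLp 2 (ι → ℝ)).symm.measurableEmbedding (fun x => ∏ i, f i (x i)),
    volume_pi, Measure.restrict_pi_pi, integral_fintype_prod_eq_prod]

variable {γ : Circle → S2} {Ω : Set S2} {x : E3}

/-- Polar coordinates on the half planes `ℝ γ + ℝ≥0 γ_s` tangent to the cone over the curve: the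
coordinates `z 0`, `z 1` and `z 2` are the parameter of the curve, the radius and the angle from
`γ`. -/
def tangentCoord (γ : Circle → S2) (z : E3) : E3 :=
  z 1 • (Real.cos (z 2) • lift γ (z 0) + Real.sin (z 2) • tangent γ (z 0))

/-- The values of `tangentCoord` parametrising the points of the open unit ball on the tangent
half planes. -/
def tangentBox : Set E3 :=
  {z | ∀ i, z i ∈ ![Set.Ico 0 (2 * Real.pi), Set.Ioo 0 1, Set.Ioo 0 Real.pi] i}

theorem mem_tangentBox {z : E3} : z ∈ tangentBox ↔
    z 0 ∈ Set.Ico 0 (2 * Real.pi) ∧ z 1 ∈ Set.Ioo (0 : ℝ) 1 ∧ z 2 ∈ Set.Ioo 0 Real.pi := by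
  rw [tangentBox, Set.mem_ofPred_eq, Fin.forall_fin_succ, Fin.forall_fin_two]
  rfl

theorem measurableSet_tangentBox : MeasurableSet tangentBox := by
  have h : tangentBox = (fun z : E3 => z 0) ⁻¹' Set.Ico 0 (2 * Real.pi) ∩
      ((fun z => z 1) ⁻¹' Set.Ioo 0 1 ∩ (fun z => z 2) ⁻¹' Set.Ioo 0 Real.pi) :=
    Set.ext fun z => mem_tangentBox
  rw [h]
  exact (measurableSet_Ico.preimage (by fun_prop)).inter
    ((measurableSet_Ioo.preimage (by fun_prop)).inter (measurableSet_Ioo.preimage (by fun_prop)))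

theorem inner_conormal_tangentCoord (γ : Circle → S2) (z : E3) :
    ⟪conormal γ (z 0), tangentCoord γ z⟫ = 0 := by
  rw [real_inner_comm, tangentCoord, real_inner_smul_left, inner_add_left, real_inner_smul_left,
    real_inner_smul_left, inner_lift_conormal, inner_tangent_conormal]
  ring

namespace IsImmersed

variable (hγ : IsImmersed γ)
include hγ

theorem inner_lift_tangentCoord (z : E3) :
    ⟪lift γ (z 0), tangentCoord γ z⟫ = z 1 * Real.cos (z 2) := by
  rw [tangentCoord, real_inner_smul_right, inner_add_right, real_inner_smul_right,
    real_inner_smul_right, inner_lift_lift, hγ.inner_lift_tangent]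
  ring

theorem inner_tangent_tangentCoord (z : E3) :
    ⟪tangent γ (z 0), tangentCoord γ z⟫ = z 1 * Real.sin (z 2) := by
  rw [tangentCoord, real_inner_smul_right, inner_add_right, real_inner_smul_right,
    real_inner_smul_right, hγ.inner_tangent_tangent, real_inner_comm, hγ.inner_lift_tangent]
  ring

theorem norm_tangentCoord (z : E3) : ‖tangentCoord γ z‖ = |z 1| := by
  rw [← sq_eq_sq₀ (norm_nonneg _) (abs_nonneg _), sq_abs, ← real_inner_self_eq_norm_sq,
    hγ.inner_self_eq_sum (z 0), hγ.inner_lift_tangentCoord, hγ.inner_tangent_tangentCoord,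
    inner_conormal_tangentCoord]
  linear_combination z 1 ^ 2 * Real.cos_sq_add_sin_sq (z 2)

theorem differentiable_tangentCoord : Differentiable ℝ (tangentCoord γ) := by
  have hL := hγ.contDiff_lift.differentiable (by simp)
  have hT := hγ.contDiff_tangent.differentiable (by simp)
  unfold tangentCoord
  fun_prop

theorem fderiv_tangentCoord_apply (z w : E3) : fderiv ℝ (tangentCoord γ) z w =
    (w 0 * (speed γ (z 0) * z 1)) • (Real.cos (z 2) • tangent γ (z 0) +
      Real.sin (z 2) • (-lift γ (z 0) + geodesicCurvature γ (z 0) • conormal γ (z 0))) +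
    w 1 • (Real.cos (z 2) • lift γ (z 0) + Real.sin (z 2) • tangent γ (z 0)) +
    (w 2 * z 1) • (-Real.sin (z 2) • lift γ (z 0) + Real.cos (z 2) • tangent γ (z 0)) := by
  have hz (i : Fin 3) : HasFDerivAt (fun z : E3 => z i) (EuclideanSpace.proj (𝕜 := ℝ) i) z :=
    (EuclideanSpace.proj (𝕜 := ℝ) i).hasFDerivAt
  have hL := (hγ.hasDerivAt_lift (z 0)).hasFDerivAt.comp z (hz 0)
  have hT := (hγ.hasDerivAt_tangent (z 0)).hasFDerivAt.comp z (hz 0)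
  have h : HasFDerivAt (tangentCoord γ) _ z :=
    (hz 1).smul (((hz 2).cos.smul hL).add ((hz 2).sin.smul hT))
  rw [h.fderiv]
  simp only [Function.comp_apply, smul_add, smul_neg, add_apply, smul_apply,
    ContinuousLinearMap.comp_apply, PiLp.proj_apply, ContinuousLinearMap.toSpanSingleton_apply,
    ContinuousLinearMap.smulRight_apply, smul_eq_mul, neg_mul, neg_smul]
  module

theorem det_fderiv_tangentCoord (z : E3) : (fderiv ℝ (tangentCoord γ) z).det =
    (geodesicCurvature γ (z 0) * speed γ (z 0)) * z 1 ^ 2 * Real.sin (z 2) := by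
  have hradius : fderiv ℝ (tangentCoord γ) z (EuclideanSpace.single 1 1) =
      Real.cos (z 2) • lift γ (z 0) + Real.sin (z 2) • tangent γ (z 0) := by
    simp [hγ.fderiv_tangentCoord_apply]
  have hangle : fderiv ℝ (tangentCoord γ) z (EuclideanSpace.single 2 1) =
      (z 1 * -Real.sin (z 2)) • lift γ (z 0) + (z 1 * Real.cos (z 2)) • tangent γ (z 0) := by
    simp [hγ.fderiv_tangentCoord_apply, smul_smul]
  have hparam : ⟪fderiv ℝ (tangentCoord γ) z (EuclideanSpace.single 0 1), conormal γ (z 0)⟫ =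
      geodesicCurvature γ (z 0) * speed γ (z 0) * z 1 * Real.sin (z 2) := by
    simp only [hγ.fderiv_tangentCoord_apply, PiLp.single_eq_same, one_mul, smul_add, smul_neg,
      ne_eq, Fin.reduceEq, not_false_eq_true, PiLp.single_eq_of_ne, zero_smul, add_zero, zero_mul,
      inner_add_left, inner_neg_left, real_inner_smul_left, inner_tangent_conormal,
      inner_lift_conormal, hγ.inner_conormal_conormal, mul_zero, neg_zero, mul_one, zero_add]
    ring
  rw [det_eq_inner_cross, hradius, hangle, cross_add_smul, ← conormal, real_inner_smul_right,
    hparam]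
  linear_combination geodesicCurvature γ (z 0) * speed γ (z 0) * z 1 ^ 2 * Real.sin (z 2) *
    Real.cos_sq_add_sin_sq (z 2)

end IsImmersed

theorem IsSmoothSimpleClosed.injOn_lift (hγ : IsSmoothSimpleClosed γ) :
    Set.InjOn (lift γ) (Set.Ico 0 (2 * Real.pi)) := fun _ hs _ ht h =>
  Circle.exp_injOn_Ico (by simp) hs ht (hγ.simple (Subtype.ext h))

theorem pos_of_periodic_of_deriv_pos {f f' : ℝ → ℝ} {c : ℝ} (hc : 0 < c)
    (hper : Function.Periodic f c) (hf : ∀ t, HasDerivAt f (f' t) t)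
    (hf' : ∀ t, f t = 0 → 0 < f' t) {a : ℝ} (ha : 0 ≤ f a) (t : ℝ) : 0 < f t := by
  have hcont : Continuous f := continuous_iff_continuousAt.2 fun t => (hf t).continuousAt
  have hright (b : ℝ) (hb : a ≤ b) : 0 ≤ f b := by
    have := image_le_of_deriv_right_lt_deriv_boundary' (f := fun t => -f t) (f' := fun t => -f' t)
      (B := 0) (B' := 0) hcont.neg.continuousOn (fun s _ => (hf s).neg.hasDerivWithinAt)
      (by simpa using ha) continuousOn_const (fun s _ => hasDerivWithinAt_const s _ (0 : ℝ))
      (fun s _ hs => by simpa using hf' s (by simpa using hs)) ⟨hb, le_rfl⟩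
    simpa using this
  have hnonneg (b : ℝ) : 0 ≤ f b := by
    obtain ⟨s, hs, hst⟩ := hper.exists_mem_Ico hc b a
    exact hst ▸ hright s hs.1
  refine (hnonneg t).lt_of_ne' fun h0 => (hf' t h0).ne' ?_
  exact IsLocalMin.hasDerivAt_eq_zero (.of_forall fun s => h0 ▸ hnonneg s) (hf t)

theorem cross_lift_tangentCoord (γ : Circle → S2) (z : E3) :
    cross (lift γ (z 0)) (tangentCoord γ z) = (z 1 * Real.sin (z 2)) • conormal γ (z 0) := by
  have h := cross_add_smul 1 0 (z 1 * Real.cos (z 2)) (z 1 * Real.sin (z 2)) (lift γ (z 0))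
    (tangent γ (z 0))
  rw [one_smul, zero_smul, add_zero, zero_mul, sub_zero, one_mul, ← smul_smul, ← smul_smul,
    ← smul_add] at h
  exact h

namespace IsPositiveBoundary

variable (hΩ : IsPositiveBoundary γ Ω)
include hΩ

theorem smul_lift_mem_closure_cone {c : ℝ} (hc : 0 ≤ c) (t : ℝ) :
    c • lift γ t ∈ closure (cone Ω) :=
  (isOpenCone_cone hΩ.isOpen).smul_mem_closure hc
    (frontier_subset_closure (hΩ.lift_mem_frontier_cone t))

variable (hγ : IsSmoothSimpleClosed γ) (hk : IsStrictlyConvex γ)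
include hγ hk

theorem lift_eq_lift_of_inner_conormal_eq_zero {s t : ℝ} (h : ⟪conormal γ t, lift γ s⟫ = 0) :
    lift γ s = lift γ t := by
  have hs := frontier_subset_closure (hΩ.lift_mem_frontier_cone s)
  obtain ⟨c, hc⟩ := Submodule.mem_span_singleton.1 ((hΩ.inner_conormal_nonneg hγ hk hs t).2 h)
  have hnorm : |c| = 1 := by
    simpa only [norm_smul, norm_lift, mul_one, Real.norm_eq_abs] using congrArg norm hc
  rcases eq_or_eq_neg_of_abs_eq hnorm with rfl | rfl
  · rw [← hc, one_smul]
  · refine absurd (hΩ.eq_zero_of_mem_closure_cone_of_neg_mem_closure_cone hγ hk hs ?_)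
      (lift_ne_zero γ s)
    simpa [← hc] using hΩ.smul_lift_mem_closure_cone zero_le_one t

theorem injOn_tangentCoord : Set.InjOn (tangentCoord γ) tangentBox := by
  intro z hz w hw h
  obtain ⟨hz0, hz1, hz2⟩ := mem_tangentBox.1 hz
  obtain ⟨hw0, hw1, hw2⟩ := mem_tangentBox.1 hw
  have hzpos := mul_pos hz1.1 (Real.sin_pos_of_mem_Ioo hz2)
  have hwpos := mul_pos hw1.1 (Real.sin_pos_of_mem_Ioo hw2)
  have hzw : 0 ≤ ⟪conormal γ (z 0), lift γ (w 0)⟫ := (hΩ.inner_conormal_nonneg hγ hk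
    (frontier_subset_closure (hΩ.lift_mem_frontier_cone (w 0))) (z 0)).1
  have hwz : 0 ≤ ⟪conormal γ (w 0), lift γ (z 0)⟫ := (hΩ.inner_conormal_nonneg hγ hk
    (frontier_subset_closure (hΩ.lift_mem_frontier_cone (z 0))) (w 0)).1
  have hcross := inner_cross_antisymm (lift γ (w 0)) (lift γ (z 0)) (tangentCoord γ z)
  rw [cross_lift_tangentCoord, h, cross_lift_tangentCoord, real_inner_smul_right,
    real_inner_smul_right, real_inner_comm, real_inner_comm (conormal γ (w 0))] at hcross
  have hzero : ⟪conormal γ (z 0), lift γ (w 0)⟫ = 0 := by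
    nlinarith [mul_nonneg hzpos.le hzw, mul_nonneg hwpos.le hwz]
  have h0 : z 0 = w 0 :=
    hγ.injOn_lift hz0 hw0 (hΩ.lift_eq_lift_of_inner_conormal_eq_zero hγ hk hzero).symm
  have h1 : z 1 = w 1 := by
    have hnorm := congrArg norm h
    rwa [hγ.isImmersed.norm_tangentCoord, hγ.isImmersed.norm_tangentCoord, abs_of_pos hz1.1,
      abs_of_pos hw1.1] at hnorm
  have hcos : z 1 * Real.cos (z 2) = z 1 * Real.cos (w 2) := by
    rw [← hγ.isImmersed.inner_lift_tangentCoord, h, h0, h1, hγ.isImmersed.inner_lift_tangentCoord]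
  have h2 : z 2 = w 2 := Real.injOn_cos (Set.Ioo_subset_Icc_self hz2)
    (Set.Ioo_subset_Icc_self hw2) (mul_left_cancel₀ hz1.1.ne' hcos)
  ext i
  fin_cases i
  exacts [h0, h1, h2]

theorem exists_inner_conormal_eq_zero (hx : x ∉ closure (cone Ω)) (hx' : -x ∉ closure (cone Ω)) :
    ∃ t ∈ Set.Ico 0 (2 * Real.pi), ⟪conormal γ t, x⟫ = 0 ∧ 0 < ⟪tangent γ t, x⟫ := by
  suffices h : ∃ t, ⟪conormal γ t, x⟫ = 0 ∧ 0 < ⟪tangent γ t, x⟫ by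
    obtain ⟨t, ht⟩ := h
    obtain ⟨s, hs, hst⟩ := Function.Periodic.exists_mem_Ico₀
      (f := fun t => (conormal γ t, tangent γ t))
      (fun t => Prod.ext (periodic_conormal γ t) (periodic_tangent γ t))
      Real.two_pi_pos t
    obtain ⟨hη, hT⟩ := Prod.ext_iff.1 hst
    dsimp only at hη hT
    exact ⟨s, hs, by rwa [← hη, ← hT]⟩
  by_contra! hle
  have hpos (y) (hy : ∀ t, 0 < ⟪conormal γ t, y⟫) : y ∈ closure (cone Ω) :=
    subset_closure ((hΩ.mem_cone_iff_inner_conormal_pos hγ hk).2 hy)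
  have hne (t) (ht : ⟪conormal γ t, x⟫ = 0) : ⟪tangent γ t, x⟫ ≠ 0 := fun ht' => by
    have hexp := hγ.isImmersed.frame_expansion t x
    rw [ht, ht', zero_smul, zero_smul, add_zero, add_zero] at hexp
    rcases le_total 0 ⟪lift γ t, x⟫ with h0 | h0
    · exact hx (hexp ▸ hΩ.smul_lift_mem_closure_cone h0 t)
    · exact hx' (hexp ▸ neg_smul ⟪lift γ t, x⟫ (lift γ t) ▸
        hΩ.smul_lift_mem_closure_cone (neg_nonneg.2 h0) t)
  have hderiv (t) (ht : ⟪conormal γ t, x⟫ = 0) :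
      0 < -(speed γ t * geodesicCurvature γ t * ⟪tangent γ t, x⟫) :=
    neg_pos.2 (mul_neg_of_pos_of_neg (mul_pos (hγ.isImmersed.speed_pos t) (hk t))
      ((hle t ht).lt_of_ne (hne t ht)))
  by_cases hnonneg : ∃ t, 0 ≤ ⟪conormal γ t, x⟫
  · obtain ⟨t, ht⟩ := hnonneg
    exact hx (hpos x (pos_of_periodic_of_deriv_pos Real.two_pi_pos
      (fun t => by simp only [periodic_conormal γ t])
      (fun t => hγ.isImmersed.hasDerivAt_inner_conormal t x) hderiv ht))
  · push Not at hnonneg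
    exact hx' (hpos (-x) fun t => by rw [inner_neg_right]; exact neg_pos.2 (hnonneg t))

theorem notMem_closure_cone_of_inner_conormal_eq_zero {t : ℝ} (hη : ⟪conormal γ t, x⟫ = 0)
    (hT : ⟪tangent γ t, x⟫ ≠ 0) : x ∉ closure (cone Ω) := fun hx => by
  obtain ⟨c, rfl⟩ := Submodule.mem_span_singleton.1 ((hΩ.inner_conormal_nonneg hγ hk hx t).2 hη)
  rw [real_inner_smul_right, real_inner_comm, hγ.isImmersed.inner_lift_tangent, mul_zero] at hT
  exact hT rfl

theorem image_tangentCoord : tangentCoord γ '' tangentBox =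
    Metric.ball 0 1 \ (closure (cone Ω) ∪ -closure (cone Ω)) := by
  refine Set.Subset.antisymm ?_ fun x ⟨hx, hxK⟩ => ?_
  · rintro _ ⟨z, hz, rfl⟩
    obtain ⟨-, hz1, hz2⟩ := mem_tangentBox.1 hz
    have hη := inner_conormal_tangentCoord γ z
    have hT : ⟪tangent γ (z 0), tangentCoord γ z⟫ ≠ 0 := by
      rw [hγ.isImmersed.inner_tangent_tangentCoord]
      exact (mul_pos hz1.1 (Real.sin_pos_of_mem_Ioo hz2)).ne'
    rw [Set.mem_sdiff, mem_ball_zero_iff, hγ.isImmersed.norm_tangentCoord, abs_of_pos hz1.1,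
      Set.mem_union, not_or, Set.mem_neg]
    exact ⟨hz1.2, hΩ.notMem_closure_cone_of_inner_conormal_eq_zero hγ hk hη hT,
      hΩ.notMem_closure_cone_of_inner_conormal_eq_zero hγ hk
        (t := z 0) (by rw [inner_neg_right, hη, neg_zero]) (by rwa [inner_neg_right, neg_ne_zero])⟩
  · rw [Set.mem_union, not_or] at hxK
    obtain ⟨t, ht, hη, hT⟩ := hΩ.exists_inner_conormal_eq_zero hγ hk hxK.1 hxK.2
    set w : ℂ := ⟨⟪lift γ t, x⟫, ⟪tangent γ t, x⟫⟩
    have hw : w ≠ 0 := fun h => hT.ne' (congrArg Complex.im h)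
    set z : E3 := !₂[t, ‖w‖, w.arg]
    have hzx : tangentCoord γ z = x := by
      conv_rhs => rw [hγ.isImmersed.frame_expansion t x, hη, zero_smul, add_zero]
      change ‖w‖ • (Real.cos w.arg • lift γ t + Real.sin w.arg • tangent γ t) = _
      rw [smul_add, smul_smul, smul_smul, Complex.norm_mul_cos_arg, Complex.norm_mul_sin_arg]
    have hnorm : ‖x‖ = ‖w‖ := by
      rw [← hzx, hγ.isImmersed.norm_tangentCoord]
      exact abs_norm w
    refine ⟨z, mem_tangentBox.2 ⟨ht, ⟨norm_pos_iff.2 hw, ?_⟩, ?_, ?_⟩, hzx⟩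
    · exact hnorm.symm.trans_lt (mem_ball_zero_iff.1 hx)
    · exact (Complex.arg_nonneg_iff.2 hT.le).lt_of_ne' fun h =>
        hT.ne' (Complex.arg_eq_zero_iff.1 h).2
    · exact Complex.arg_lt_pi_iff.2 (Or.inr hT.ne')

theorem volume_real_image_tangentCoord :
    (volume : Measure E3).real (tangentCoord γ '' tangentBox) =
      2 / 3 * arcIntegral γ (geodesicCurvature γ) := by
  let S : Fin 3 → Set ℝ := ![Set.Ico 0 (2 * Real.pi), Set.Ioo 0 1, Set.Ioo 0 Real.pi]
  let f : Fin 3 → ℝ → ℝ := ![fun t => geodesicCurvature γ t * speed γ t, fun r => r ^ 2, Real.sin]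
  calc (volume : Measure E3).real (tangentCoord γ '' tangentBox)
      = ∫ z in tangentBox, |(fderiv ℝ (tangentCoord γ) z).det| := by
        rw [← setIntegral_one_eq_measureReal, integral_image_eq_integral_abs_det_fderiv_smul volume
          measurableSet_tangentBox
          (fun z _ => (hγ.isImmersed.differentiable_tangentCoord z).hasFDerivAt.hasFDerivWithinAt)
          (hΩ.injOn_tangentCoord hγ hk)]
        simp only [smul_eq_mul, mul_one]
    _ = ∫ z in tangentBox, ∏ i, f i (z i) := by
        refine setIntegral_congr_fun measurableSet_tangentBox fun z hz => ?_
        obtain ⟨-, hz1, hz2⟩ := mem_tangentBox.1 hz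
        rw [hγ.isImmersed.det_fderiv_tangentCoord, abs_of_pos, Fin.prod_univ_three]
        · rfl
        · have := Real.sin_pos_of_mem_Ioo hz2
          have := hk (z 0)
          have := hγ.isImmersed.speed_pos (z 0)
          have := hz1.1
          positivity
    _ = ∏ i, ∫ x in S i, f i x := setIntegral_prod_eq_prod_setIntegral S f
    _ = arcIntegral γ (geodesicCurvature γ) * (1 / 3) * 2 := by
        rw [Fin.prod_univ_three]
        change (∫ t in Set.Ico 0 (2 * Real.pi), geodesicCurvature γ t * speed γ t) *
          (∫ r in Set.Ioo (0 : ℝ) 1, r ^ 2) * (∫ θ in Set.Ioo 0 Real.pi, Real.sin θ) = _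
        rw [integral_Ico_eq_integral_Ioo, ← integral_Ioc_eq_integral_Ioo,
          ← integral_Ioc_eq_integral_Ioo, ← integral_Ioc_eq_integral_Ioo,
          ← intervalIntegral.integral_of_le Real.two_pi_pos.le,
          ← intervalIntegral.integral_of_le zero_le_one,
          ← intervalIntegral.integral_of_le Real.pi_pos.le, integral_pow, integral_sin, arcIntegral]
        norm_num
    _ = 2 / 3 * arcIntegral γ (geodesicCurvature γ) := by ring

end IsPositiveBoundary

end TangentCoord

section GaussBonnet

variable {γ : Circle → S2} {Ω : Set S2}

theorem area_eq_three_mul_volume_real (hΩ : IsOpen Ω) :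
    area Ω = 3 * (volume : Measure E3).real (cone Ω ∩ Metric.ball 0 1) := by
  rw [area, measureReal_def, Measure.toSphere_apply' _ hΩ.measurableSet,
    Ioo_smul_image_coe_eq_cone_inter_ball, ENNReal.toReal_mul, measureReal_def]
  simp

theorem measureReal_union_neg {G : Type*} [MeasurableSpace G] [InvolutiveNeg G] [MeasurableNeg G]
    {μ : Measure G} [μ.IsNegInvariant] {S : Set G} (hS : NullMeasurableSet S μ) (hfin : μ S ≠ ⊤)
    (h : μ (S ∩ -S) = 0) : μ.real (S ∪ -S) = 2 * μ.real S := by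
  have hneg : NullMeasurableSet (-S) μ :=
    hS.preimage (Measure.measurePreserving_neg μ).quasiMeasurePreserving
  rw [measureReal_union₀ hneg h hfin (by rwa [Measure.measure_neg]), measureReal_def μ (-S),
    Measure.measure_neg, ← measureReal_def, two_mul]

namespace IsPositiveBoundary

theorem area_pos (hΩ : IsPositiveBoundary γ Ω) : 0 < area Ω :=
  ENNReal.toReal_pos (hΩ.isOpen.measure_ne_zero _ hΩ.isConnected.nonempty) (measure_ne_top _ _)

theorem area_eq_two_pi_sub_arcIntegral (hΩ : IsPositiveBoundary γ Ω)
    (hγ : IsSmoothSimpleClosed γ) (hk : IsStrictlyConvex γ) :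
    area Ω = 2 * Real.pi - arcIntegral γ (geodesicCurvature γ) := by
  set B : Set E3 := Metric.ball 0 1
  set C := closure (cone Ω)
  have hball : (volume : Measure E3).real B = Real.pi * 4 / 3 := by
    rw [measureReal_def, EuclideanSpace.volume_ball_fin_three, ENNReal.ofReal_one, one_pow, one_mul,
      ENNReal.toReal_ofReal (by positivity)]
  have hdiff : (volume : Measure E3).real (B \ (C ∪ -C)) =
      2 / 3 * arcIntegral γ (geodesicCurvature γ) := by
    rw [← hΩ.image_tangentCoord hγ hk, hΩ.volume_real_image_tangentCoord hγ hk]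
  have hcone : (volume : Measure E3).real (C ∩ B) = (volume : Measure E3).real (cone Ω ∩ B) :=
    measureReal_congr ((closure_ae_eq_of_null_frontier
      ((hΩ.convex_cone hγ hk).addHaar_frontier volume)).inter (ae_eq_refl B))
  have hunion : (volume : Measure E3).real (B ∩ (C ∪ -C)) =
      2 * (volume : Measure E3).real (C ∩ B) := by
    have hB : -B = B := by simp [B]
    have hzero : (C ∩ B) ∩ -(C ∩ B) ⊆ {0} := fun x hx =>
      hΩ.eq_zero_of_mem_closure_cone_of_neg_mem_closure_cone hγ hk hx.1.1 hx.2.1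
    rw [← measureReal_union_neg (isClosed_closure.measurableSet.inter
      measurableSet_ball).nullMeasurableSet
      (measure_ne_top_of_subset Set.inter_subset_right measure_ball_lt_top.ne)
      (measure_mono_null hzero (measure_singleton 0)), Set.inter_neg, hB,
      ← Set.union_inter_distrib_right, Set.inter_comm]
  have hsplit := measureReal_inter_add_sdiff (μ := (volume : Measure E3)) (s := B) (t := C ∪ -C)
    (isClosed_closure.union isClosed_closure.neg).measurableSet measure_ball_lt_top.ne
  rw [hball, hdiff, hunion, hcone] at hsplit
  rw [area_eq_three_mul_volume_real hΩ.isOpen]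
  linarith

end IsPositiveBoundary

end GaussBonnet

section Remainder

variable {γ : Circle → S2} {f : ℝ → ℝ}

theorem remainderDenom_pos (a b : ℝ) : 0 < remainderDenom a b := by
  have habs : |a * b| ≤ √((1 + a ^ 2) * (1 + b ^ 2)) :=
    Real.abs_le_sqrt (by nlinarith [sq_nonneg a, sq_nonneg b])
  have hneg := neg_abs_le (a * b)
  rw [remainderDenom]
  linarith

theorem sq_sub_div_remainderDenom (a b : ℝ) :
    (a - b) ^ 2 / remainderDenom a b = √(1 + a ^ 2) * √(1 + b ^ 2) - 1 - a * b := by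
  rw [div_eq_iff (remainderDenom_pos a b).ne', remainderDenom, Real.sqrt_mul (by positivity)]
  have ha : √(1 + a ^ 2) ^ 2 = 1 + a ^ 2 := Real.sq_sqrt (by positivity)
  have hb : √(1 + b ^ 2) ^ 2 = 1 + b ^ 2 := Real.sq_sqrt (by positivity)
  linear_combination (-√(1 + b ^ 2) ^ 2) * ha - (1 + a ^ 2) * hb

theorem sq_sub_div_remainderDenom_nonneg (a b : ℝ) : 0 ≤ (a - b) ^ 2 / remainderDenom a b :=
  div_nonneg (sq_nonneg _) (remainderDenom_pos a b).le

theorem sq_sub_div_remainderDenom_eq_zero_iff {a b : ℝ} :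
    (a - b) ^ 2 / remainderDenom a b = 0 ↔ a = b := by
  simp [(remainderDenom_pos a b).ne', sub_eq_zero]

theorem arcIntegral_nonneg (γ : Circle → S2) (hf : ∀ t, 0 ≤ f t) : 0 ≤ arcIntegral γ f :=
  intervalIntegral.integral_nonneg Real.two_pi_pos.le fun t _ =>
    mul_nonneg (hf t) (norm_nonneg _)

theorem remainder_nonneg (γ : Circle → S2) : 0 ≤ remainder γ :=
  arcIntegral_nonneg γ fun _ => arcIntegral_nonneg γ fun _ => sq_sub_div_remainderDenom_nonneg _ _

namespace IsImmersed

variable (hγ : IsImmersed γ)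
include hγ

theorem arcIntegral_pos (hf : Continuous f) (hf₀ : ∀ t, 0 ≤ f t) {t : ℝ}
    (ht : t ∈ Set.Icc 0 (2 * Real.pi)) (hpos : 0 < f t) : 0 < arcIntegral γ f :=
  intervalIntegral.integral_pos Real.two_pi_pos
    (hf.mul hγ.contDiff_speed.continuous).continuousOn
    (fun t _ => mul_nonneg (hf₀ t) (hγ.speed_pos t).le) ⟨t, ht, mul_pos hpos (hγ.speed_pos t)⟩

theorem arcIntegral_eq_zero_iff (hf : Continuous f) (hf₀ : ∀ t, 0 ≤ f t)
    (hper : Function.Periodic f (2 * Real.pi)) : arcIntegral γ f = 0 ↔ ∀ t, f t = 0 := by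
  refine ⟨fun h t => ?_, fun h => by simp [arcIntegral, h]⟩
  obtain ⟨s, hs, hst⟩ := hper.exists_mem_Ico₀ Real.two_pi_pos t
  by_contra hne
  exact (hγ.arcIntegral_pos hf hf₀ (Set.Ico_subset_Icc_self hs)
    (hst ▸ (hf₀ t).lt_of_ne' hne)).ne' h

theorem arcIntegral_const_mul_sub_sub (a b c : ℝ) :
    arcIntegral γ (fun t => a * √(1 + geodesicCurvature γ t ^ 2) - b - c * geodesicCurvature γ t) =
      a * totalCurvature γ - b * length γ - c * arcIntegral γ (geodesicCurvature γ) := by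
  have hk := hγ.contDiff_geodesicCurvature.continuous
  have hv := hγ.contDiff_speed.continuous
  simp only [totalCurvature, length, arcIntegral, ← intervalIntegral.integral_const_mul]
  rw [← intervalIntegral.integral_sub, ← intervalIntegral.integral_sub]
  · congr with t
    ring
  all_goals exact Continuous.intervalIntegrable (by fun_prop) _ _

theorem arcIntegral_sq_sub_div_remainderDenom (s : ℝ) :
    arcIntegral γ (fun σ => (geodesicCurvature γ s - geodesicCurvature γ σ) ^ 2 /
        remainderDenom (geodesicCurvature γ s) (geodesicCurvature γ σ)) =
      totalCurvature γ * √(1 + geodesicCurvature γ s ^ 2) - length γ -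
        arcIntegral γ (geodesicCurvature γ) * geodesicCurvature γ s := by
  simp only [sq_sub_div_remainderDenom]
  rw [hγ.arcIntegral_const_mul_sub_sub]
  ring

theorem remainder_eq : remainder γ =
    totalCurvature γ ^ 2 - length γ ^ 2 - arcIntegral γ (geodesicCurvature γ) ^ 2 := by
  simp only [remainder, hγ.arcIntegral_sq_sub_div_remainderDenom]
  rw [hγ.arcIntegral_const_mul_sub_sub]
  ring

theorem remainder_eq_zero_iff :
    remainder γ = 0 ↔ ∃ κ, ∀ t, geodesicCurvature γ t = κ := by
  have hk := hγ.contDiff_geodesicCurvature.continuous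
  have hper := periodic_geodesicCurvature γ
  have hinner : Continuous fun s => arcIntegral γ fun σ =>
      (geodesicCurvature γ s - geodesicCurvature γ σ) ^ 2 /
        remainderDenom (geodesicCurvature γ s) (geodesicCurvature γ σ) := by
    simp only [hγ.arcIntegral_sq_sub_div_remainderDenom]
    fun_prop
  have hkernel (s : ℝ) : Continuous fun σ =>
      (geodesicCurvature γ s - geodesicCurvature γ σ) ^ 2 /
        remainderDenom (geodesicCurvature γ s) (geodesicCurvature γ σ) := by
    simp only [sq_sub_div_remainderDenom]
    fun_prop
  rw [remainder, hγ.arcIntegral_eq_zero_iff hinner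
    (fun _ => arcIntegral_nonneg γ fun _ => sq_sub_div_remainderDenom_nonneg _ _)
    (fun s => by simp only [hper s])]
  have hzero (s : ℝ) := hγ.arcIntegral_eq_zero_iff (hkernel s)
    (fun _ => sq_sub_div_remainderDenom_nonneg _ _) (fun σ => by simp only [hper σ])
  simp only [hzero, sq_sub_div_remainderDenom_eq_zero_iff]
  exact ⟨fun h => ⟨geodesicCurvature γ 0, fun t => h t 0⟩,
    fun ⟨κ, hκ⟩ s σ => (hκ s).trans (hκ σ).symm⟩

end IsImmersed

end Remainder

section GeodesicCircle

variable {γ : Circle → S2}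

theorem angle_eq_iff_inner_eq_cos {V : Type*} [NormedAddCommGroup V] [InnerProductSpace ℝ V]
    {x p : V} (hx : ‖x‖ = 1) (hp : ‖p‖ = 1) {r : ℝ} (hr : r ∈ Set.Icc 0 Real.pi) :
    InnerProductGeometry.angle x p = r ↔ ⟪x, p⟫ = Real.cos r := by
  rw [InnerProductGeometry.inner_eq_cos_angle_of_norm_eq_one hx hp]
  exact (Real.injOn_cos.eq_iff
    ⟨InnerProductGeometry.angle_nonneg x p, InnerProductGeometry.angle_le_pi x p⟩ hr).symm

theorem isGeodesicCircle_iff_exists_inner_eq : IsGeodesicCircle γ ↔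
    ∃ P : E3, ∃ c, |c| < ‖P‖ ∧ Set.range γ = {x : S2 | ⟪(x : E3), P⟫ = c} := by
  constructor
  · rintro ⟨p, r, hr, hrange⟩
    refine ⟨p, Real.cos r, ?_, ?_⟩
    · rw [norm_eq_of_mem_sphere, ← sq_lt_one_iff_abs_lt_one]
      nlinarith [Real.sin_sq_add_cos_sq r, Real.sin_pos_of_mem_Ioo hr]
    · ext x
      rw [hrange, Set.mem_ofPred_eq, Set.mem_ofPred_eq, angle_eq_iff_inner_eq_cos
        (norm_eq_of_mem_sphere x) (norm_eq_of_mem_sphere p) (Set.Ioo_subset_Icc_self hr)]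
  · rintro ⟨P, c, hc, hrange⟩
    have hP : 0 < ‖P‖ := (abs_nonneg c).trans_lt hc
    obtain ⟨hlow, hupp⟩ := abs_lt.1 hc
    have hp : ‖‖P‖⁻¹ • P‖ = 1 := by
      rw [norm_smul, norm_inv, norm_norm, inv_mul_cancel₀ hP.ne']
    have hcos : Real.cos (Real.arccos (c / ‖P‖)) = c / ‖P‖ := Real.cos_arccos
      (by rw [le_div_iff₀ hP]; linarith) (by rw [div_le_one hP]; exact hupp.le)
    refine ⟨⟨‖P‖⁻¹ • P, mem_sphere_zero_iff_norm.2 hp⟩, Real.arccos (c / ‖P‖),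
      ⟨Real.arccos_pos.2 ((div_lt_one hP).2 hupp), ?_⟩, ?_⟩
    · refine (Real.arccos_le_pi _).lt_of_ne fun h => ?_
      rw [Real.arccos_eq_pi, div_le_iff₀ hP] at h
      linarith
    · ext x
      rw [hrange, Set.mem_ofPred_eq, Set.mem_ofPred_eq, angle_eq_iff_inner_eq_cos
        (norm_eq_of_mem_sphere _) hp ⟨Real.arccos_nonneg _, Real.arccos_le_pi _⟩, hcos,
        real_inner_smul_right, inv_mul_eq_div, div_left_inj' hP.ne']

theorem exists_forall_mem_Icc_of_periodic {f : ℝ → ℝ} {c : ℝ} (hf : Continuous f)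
    (hper : Function.Periodic f c) (hc : c ≠ 0) : ∃ s t, ∀ u, f u ∈ Set.Icc (f s) (f t) := by
  have hcompact := hper.compact_of_continuous hc hf
  obtain ⟨_, ⟨s, rfl⟩, hs⟩ := hcompact.exists_isLeast (Set.range_nonempty f)
  obtain ⟨_, ⟨t, rfl⟩, ht⟩ := hcompact.exists_isGreatest (Set.range_nonempty f)
  exact ⟨s, t, fun u => ⟨hs ⟨u, rfl⟩, ht ⟨u, rfl⟩⟩⟩

namespace IsImmersed

variable (hγ : IsImmersed γ) {κ : ℝ}
include hγ

theorem smul_lift_add_conormal_eq (hκ : ∀ t, geodesicCurvature γ t = κ) (s t : ℝ) :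
    κ • lift γ s + conormal γ s = κ • lift γ t + conormal γ t := by
  have hderiv (t : ℝ) : HasDerivAt (fun t => κ • lift γ t + conormal γ t) 0 t := by
    refine (((hγ.hasDerivAt_lift t).const_smul κ).add (hγ.hasDerivAt_conormal t)).congr_deriv ?_
    rw [hκ]
    module
  exact is_const_of_deriv_eq_zero (fun t => (hderiv t).differentiableAt)
    (fun t => (hderiv t).deriv) s t

theorem norm_smul_lift_add_conormal (κ t : ℝ) :
    ‖κ • lift γ t + conormal γ t‖ = √(1 + κ ^ 2) := by
  rw [eq_comm, Real.sqrt_eq_iff_eq_sq (by positivity) (norm_nonneg _),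
    ← real_inner_self_eq_norm_sq, real_inner_add_add_self, real_inner_smul_left,
    real_inner_smul_left, real_inner_smul_right, inner_lift_lift, inner_lift_conormal,
    hγ.inner_conormal_conormal]
  ring

theorem exists_lift_eq_of_inner_eq (hκ : ∀ t, geodesicCurvature γ t = κ) {x : E3}
    (hx : ‖x‖ = 1) (hplane : ∀ t, κ * ⟪lift γ t, x⟫ + ⟪conormal γ t, x⟫ = κ) :
    ∃ t, lift γ t = x := by
  by_contra! hne
  have hlift_ne (t : ℝ) : ⟪lift γ t, x⟫ ≠ 1 := fun h =>
    hne t ((inner_eq_one_iff_of_norm_eq_one (norm_lift γ t) hx).1 h)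
  have hcrit {t : ℝ} (ht : ⟪tangent γ t, x⟫ = 0) : (1 + κ ^ 2) * ⟪lift γ t, x⟫ = κ ^ 2 - 1 := by
    have hsum := hγ.inner_self_eq_sum t x
    rw [real_inner_self_eq_norm_sq, hx, ht, eq_sub_of_add_eq' (hplane t)] at hsum
    apply mul_left_cancel₀ (sub_ne_zero.2 (hlift_ne t))
    linear_combination -hsum
  have htangent {t : ℝ} (h : IsLocalExtr (fun s => ⟪lift γ s, x⟫) t) : ⟪tangent γ t, x⟫ = 0 :=
    (mul_eq_zero.1 (h.hasDerivAt_eq_zero (hγ.hasDerivAt_inner_lift t x))).resolve_left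
      (hγ.speed_pos t).ne'
  have hcont : Continuous fun s => ⟪lift γ s, x⟫ :=
    hγ.contDiff_lift.continuous.inner continuous_const
  have hper : Function.Periodic (fun s => ⟪lift γ s, x⟫) (2 * Real.pi) := fun s => by
    simp only [periodic_lift γ s]
  obtain ⟨a, b, hab⟩ := exists_forall_mem_Icc_of_periodic hcont hper Real.two_pi_pos.ne'
  have hmin := hcrit (htangent (Or.inl (Filter.Eventually.of_forall fun t => (hab t).1)))
  have hmax := hcrit (htangent (Or.inr (Filter.Eventually.of_forall fun t => (hab t).2)))
  have hconst (t : ℝ) : (1 + κ ^ 2) * ⟪lift γ t, x⟫ = κ ^ 2 - 1 :=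
    le_antisymm (hmax ▸ mul_le_mul_of_nonneg_left (hab t).2 (by positivity))
      (hmin ▸ mul_le_mul_of_nonneg_left (hab t).1 (by positivity))
  have hT (t : ℝ) : ⟪tangent γ t, x⟫ = 0 := htangent <| Or.inl <| Filter.Eventually.of_forall
    fun s => (mul_left_cancel₀ (by positivity) ((hconst t).trans (hconst s).symm)).le
  have hderiv := hγ.hasDerivAt_inner_tangent 0 x
  simp only [hT, hκ] at hderiv
  have hzero := (mul_eq_zero.1 (hderiv.unique (hasDerivAt_const 0 (0 : ℝ)))).resolve_left
    (hγ.speed_pos 0).ne'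
  linarith [hplane 0, hconst 0, congrArg (κ * ·) (hplane 0)]

theorem isGeodesicCircle_of_geodesicCurvature_eq (hκ : ∀ t, geodesicCurvature γ t = κ) :
    IsGeodesicCircle γ := by
  rw [isGeodesicCircle_iff_exists_inner_eq]
  have hinner (t : ℝ) (x : E3) :
      ⟪x, κ • lift γ 0 + conormal γ 0⟫ = κ * ⟪lift γ t, x⟫ + ⟪conormal γ t, x⟫ := by
    rw [hγ.smul_lift_add_conormal_eq hκ 0 t, inner_add_right, real_inner_smul_right,
      real_inner_comm, real_inner_comm (conormal γ t)]
  refine ⟨κ • lift γ 0 + conormal γ 0, κ, ?_, Set.Subset.antisymm ?_ fun x hx => ?_⟩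
  · rw [hγ.norm_smul_lift_add_conormal]
    exact Real.lt_sqrt_of_sq_lt (by rw [sq_abs]; linarith)
  · rintro _ ⟨z, rfl⟩
    obtain ⟨t, rfl⟩ := Circle.exp_surjective z
    rw [Set.mem_ofPred_eq, hinner t]
    change κ * ⟪lift γ t, lift γ t⟫ + ⟪conormal γ t, lift γ t⟫ = κ
    rw [inner_lift_lift, real_inner_comm, inner_lift_conormal, mul_one, add_zero]
  · obtain ⟨t, ht⟩ := hγ.exists_lift_eq_of_inner_eq hκ (norm_eq_of_mem_sphere x)
      fun t => (hinner t x).symm.trans hx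
    exact ⟨Circle.exp t, Subtype.ext ht⟩

theorem exists_geodesicCurvature_eq_of_inner_lift_eq {P : E3} {c : ℝ} (hc : |c| < ‖P‖)
    (h : ∀ t, ⟪lift γ t, P⟫ = c) : ∃ κ, ∀ t, geodesicCurvature γ t = κ := by
  have hT (t : ℝ) : ⟪tangent γ t, P⟫ = 0 := by
    have hderiv := hγ.hasDerivAt_inner_lift t P
    simp only [h] at hderiv
    simpa [(hγ.speed_pos t).ne'] using hderiv.unique (hasDerivAt_const t c)
  have hη_deriv (t : ℝ) : HasDerivAt (fun t => ⟪conormal γ t, P⟫) 0 t := by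
    simpa [hT] using hγ.hasDerivAt_inner_conormal t P
  have hη (t : ℝ) : ⟪conormal γ t, P⟫ = ⟪conormal γ 0, P⟫ :=
    is_const_of_deriv_eq_zero (fun t => (hη_deriv t).differentiableAt)
      (fun t => (hη_deriv t).deriv) t 0
  have hη_ne : ⟪conormal γ 0, P⟫ ≠ 0 := fun h0 => by
    have hsum := hγ.inner_self_eq_sum 0 P
    rw [real_inner_self_eq_norm_sq, h, hT, h0, ← sq_abs c] at hsum
    nlinarith [abs_nonneg c]
  refine ⟨c / ⟪conormal γ 0, P⟫, fun t => ?_⟩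
  have hderiv := hγ.hasDerivAt_inner_tangent t P
  simp only [hT, h, hη] at hderiv
  have hzero := (mul_eq_zero.1 (hderiv.unique (hasDerivAt_const t (0 : ℝ)))).resolve_left
    (hγ.speed_pos t).ne'
  rw [eq_div_iff hη_ne]
  linarith

theorem isGeodesicCircle_iff :
    IsGeodesicCircle γ ↔ ∃ κ, ∀ t, geodesicCurvature γ t = κ := by
  refine ⟨fun h => ?_, fun ⟨κ, hκ⟩ => hγ.isGeodesicCircle_of_geodesicCurvature_eq hκ⟩
  obtain ⟨P, c, hc, hrange⟩ := isGeodesicCircle_iff_exists_inner_eq.1 h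
  exact hγ.exists_geodesicCurvature_eq_of_inner_lift_eq hc fun t =>
    hrange.subset ⟨Circle.exp t, rfl⟩

end IsImmersed

end GeodesicCircle

end

end SphereCurve

open SphereCurve in
theorem mainTheorem1 (γ : Circle → S2) (Ω : Set S2)
    (hγ : IsSmoothSimpleClosed γ) (hΩ : IsPositiveBoundary γ Ω) (hconv : IsStrictlyConvex γ) :
    (0 < area Ω ∧ area Ω < 2 * Real.pi) ∧
    length γ ^ 2 - area Ω * (4 * Real.pi - area Ω) ≤ totalCurvature γ ^ 2 - 4 * Real.pi ^ 2 ∧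
    length γ ^ 2 - area Ω * (4 * Real.pi - area Ω)
      = totalCurvature γ ^ 2 - 4 * Real.pi ^ 2 - remainder γ ∧
    (∀ s σ : ℝ, 0 < remainderDenom (geodesicCurvature γ s) (geodesicCurvature γ σ)) ∧
    0 ≤ remainder γ ∧
    (length γ ^ 2 - area Ω * (4 * Real.pi - area Ω) = totalCurvature γ ^ 2 - 4 * Real.pi ^ 2
      ↔ IsGeodesicCircle γ) := by
  have hγ' := hγ.isImmersed
  have hGaussBonnet := hΩ.area_eq_two_pi_sub_arcIntegral hγ hconv
  have hk : 0 < arcIntegral γ (geodesicCurvature γ) :=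
    hγ'.arcIntegral_pos hγ'.contDiff_geodesicCurvature.continuous (fun t => (hconv t).le)
      (Set.left_mem_Icc.2 Real.two_pi_pos.le) (hconv 0)
  have hR := remainder_nonneg γ
  have hdeficit : length γ ^ 2 - area Ω * (4 * Real.pi - area Ω)
      = totalCurvature γ ^ 2 - 4 * Real.pi ^ 2 - remainder γ := by
    rw [hγ'.remainder_eq, hGaussBonnet]
    ring
  refine ⟨⟨hΩ.area_pos, by linarith⟩, by linarith, hdeficit,
    fun s σ => remainderDenom_pos _ _, hR, ?_⟩
  rw [hdeficit, sub_eq_self, hγ'.remainder_eq_zero_iff, hγ'.isGeodesicCircle_iff]
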